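/- **Theorem (Existence of solutions).** Let $\Omega,\Sigma\subset\mathbb R^d$ be bounded open sets, $q\in(1,2]$, $Y$ a real Banach space, $A:L^q(\Omega)\to Y$ linear and bounded, $\lambda>0$, $\nu\in(0,1)$, and put $s_{\mathcal R}(\nu)=\frac{\nu}{\min(\nu,1-\nu)}$, $s_{\mathcal G}(\nu)=\frac{1-\nu}{\min(\nu,1-\nu)}$. *Notation.* For a bounded open set $\omega$, let $\mathcal M(\omega)=C_0(\omega)^*$ be the space of finite Radon measures with the dual norm $\|\cdot\|_{\mathcal M}$; a function $f\in L^q(\omega)$ is identified with the measure $\phi\mapsto\int_\omega f\phi\,dx$. Write $\omega-\Sigma=\{x-y: x\in\omega,\,y\in\Sigma\}$. For $\mu\in\mathcal M(\omega-\Sigma)$ and $g\in L^2(\Sigma)$, the convolution $\mu*g\in L^q(\omega)$ is the unique function with $$\int_\omega(\mu*g)\,\phi\,dx=\int_{\omega-\Sigma}\int_\Sigma\tilde\phi(x+y)\,g(x)\,dx\,d\mu(y)\qquad\text{for all }\phi\in C_c(\omega),$$ where $\tilde\phi$ is the extension of $\phi$ by zero to $\mathbb R^d$. *Generative prior.* Let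 $L\ge1$, $N_0=1$, $N_1,\dots,N_L\in\mathbb N$, and let $E^l\subset\{1,\dots,N_l\}\times\{1,\dots,N_{l-1}\}$ $(1\le l\le L)$ be such that for every $n\in\{1,\dots,N_l\}$ there is a $k$ with $(n,k)\in E^l$. Set $\Omega^0=\Omega$, $\Omega^{l}=\Omega^{l-1}-\Sigma$, $M^l=\mathcal M(\Omega^l)^{N_l}$, $M=M^1\times\dots\times M^L$, $\Theta^l=L^2(\Sigma)^{E^l}$, $\Theta=\Theta^1\times\dots\times\Theta^L$. For $\mu^l\in M^l$ and $\theta^l\in\Theta^l$ let $\mu^l*_l\theta^l=\bigl(\sum_{n:(n,k)\in E^l}\mu^l_n*\theta^l_{n,k}\bigr)_{k=1}^{N_{l-1}}$, a vector of functions in $L^q(\Omega^{l-1})$. Let $Z:\Theta\to\mathbb R^{N_c}$ be linear and bounded, and let $\mathcal J_l:M^l\to[0,\infty]$ $(1\le l\le L-1)$ be (sequentially) weak* lower semicontinuous with $\mathcal J_l(0)=0$. For $v\in L^q(\Omega)$ define $$\mathcal G(v)=\inf\Bigl\{\sum_{l=1}^L\sum_{n=1}^{N_l}\|\mu^l_n\|_{\mathcal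 M}+\sum_{l=2}^L\mathcal J_{l-1}\bigl(\mu^{l-1}-\mu^l*_l\theta^l\bigr)\Bigr\},$$ where the infimum is over all $(\mu,\theta)\in M\times\Theta$ with $v=\mu^1*_1\theta^1$, $\|\theta^l_{n,k}\|_2\le1$ for all $l$ and all $(n,k)\in E^l$, and $Z\theta=0$; $\mathcal G(v)=\infty$ if there is no such $(\mu,\theta)$. *Assumptions.* 1. $\mathcal D_y:Y\to[0,\infty]$ is proper (finite somewhere), coercive ($\mathcal D_y(z)\to\infty$ as $\|z\|_Y\to\infty$), lower semicontinuous and convex. 2. $\mathcal R:L^q(\Omega)\to[0,\infty]$ is proper and (sequentially) weakly lower semicontinuous, and there are a closed subspace $U\subset L^q(\Omega)$, a continuous linear projection $P_U:L^q(\Omega)\to U$ onto $U$ and a constant $C>0$ such that $\mathcal R(u)=\mathcal R(u+v)$ and $\|u-P_Uu\|_q\le C\,\mathcal R(u)$ for all $u\in L^q(\Omega)$, $v\in U$. 3. Either $U$ is finite dimensional, or $U\cap\ker A$ has a complement $W$ in $U$ for which there is a constant $K>0$ with $\|u\|_q\le K\|Au\|_Y$ for all $u\in W$. 4. There is $\hat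 u\in L^q(\Omega)$ with $\mathcal R(\hat u)<\infty$ and $\mathcal D_y(A\hat u)<\infty$. Then the problem $$\min_{u,v\in L^q(\Omega)}\ \lambda\,\mathcal D_y(Au)+s_{\mathcal R}(\nu)\,\mathcal R(u-v)+s_{\mathcal G}(\nu)\,\mathcal G(v)$$ has a minimizer $(u,v)\in L^q(\Omega)^2$. -/

import Mathlib

open MeasureTheory Filter Topology
open scoped ENNReal NNReal Pointwise ZeroAtInfty CompactlySupported

noncomputable section

namespace GenPrior

abbrev Eucl (d : ℕ) : Type := EuclideanSpace ℝ (Fin d)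

/-- Bounded open subsets of `ℝᵈ`. -/
structure BddOpen (d : ℕ) where
  carrier : Set (Eucl d)
  isOpen : IsOpen carrier
  isBounded : Bornology.IsBounded carrier

variable {d : ℕ}

namespace BddOpen

instance : CoeSort (BddOpen d) Type := ⟨fun Ω => Ω.carrier⟩

/-- The difference set `Ω - S = {x - y | x ∈ Ω, y ∈ S}`. -/
def sub (Ω S : BddOpen d) : BddOpen d where
  carrier := Ω.carrier - S.carrier
  isOpen := Ω.isOpen.sub_right
  isBounded := Ω.isBounded.sub S.isBounded

/-- Lebesgue measure on `Ω`. -/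
abbrev vol (Ω : BddOpen d) : Measure (Eucl d) := volume.restrict Ω.carrier

instance (Ω : BddOpen d) : IsFiniteMeasure Ω.vol :=
  ⟨by simpa using Ω.isBounded.measure_lt_top⟩

end BddOpen

/-- The extension by zero of a function on `Ω` to all of `ℝᵈ`. -/
def zeroExt (Ω : BddOpen d) (f : Ω → ℝ) : Eucl d → ℝ :=
  Function.extend Subtype.val f 0

theorem zeroExt_apply_mem (Ω : BddOpen d) (f : Ω → ℝ) (x : Ω) : zeroExt Ω f x = f x :=
  Subtype.val_injective.extend_apply f 0 x

theorem zeroExt_apply_notMem (Ω : BddOpen d) (f : Ω → ℝ) {x : Eucl d} (hx : x ∉ Ω.carrier) :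
    zeroExt Ω f x = 0 := by
  unfold zeroExt
  rw [Function.extend_apply']
  · rfl
  · rintro ⟨a, rfl⟩
    exact hx a.2

theorem measurable_zeroExt (Ω : BddOpen d) {f : Ω → ℝ} (hf : Continuous f) :
    Measurable (zeroExt Ω f) :=
  (MeasurableEmbedding.subtype_coe Ω.isOpen.measurableSet).measurable_extend
    hf.measurable measurable_const

theorem norm_zeroExt_le (Ω : BddOpen d) {f : Ω → ℝ} {C : ℝ} (hC : 0 ≤ C)
    (hf : ∀ x, ‖f x‖ ≤ C) (x : Eucl d) : ‖zeroExt Ω f x‖ ≤ C := by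
  by_cases hx : x ∈ Ω.carrier
  · exact (zeroExt_apply_mem Ω f ⟨x, hx⟩).symm ▸ hf ⟨x, hx⟩
  · rw [zeroExt_apply_notMem Ω f hx]; simpa using hC

theorem zeroExt_add (Ω : BddOpen d) (f g : Ω → ℝ) (x : Eucl d) :
    zeroExt Ω (f + g) x = zeroExt Ω f x + zeroExt Ω g x := by
  by_cases hx : x ∈ Ω.carrier
  · simpa using congrArg₂ (· = ·) (zeroExt_apply_mem Ω (f + g) ⟨x, hx⟩)
      (congrArg₂ (· + ·) (zeroExt_apply_mem Ω f ⟨x, hx⟩) (zeroExt_apply_mem Ω g ⟨x, hx⟩))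
  · simp [zeroExt_apply_notMem Ω _ hx]

theorem zeroExt_smul (Ω : BddOpen d) (c : ℝ) (f : Ω → ℝ) (x : Eucl d) :
    zeroExt Ω (c • f) x = c * zeroExt Ω f x := by
  by_cases hx : x ∈ Ω.carrier
  · have h1 := zeroExt_apply_mem Ω (c • f) ⟨x, hx⟩
    have h2 := zeroExt_apply_mem Ω f ⟨x, hx⟩
    simp only [Pi.smul_apply, smul_eq_mul] at h1 h2
    rw [h1, h2]
  · simp [zeroExt_apply_notMem Ω _ hx]

theorem zeroExt_eq_zero (Ω : BddOpen d) (φ : C_c(Ω, ℝ)) {x : Eucl d}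
    (hx : x ∉ Subtype.val '' tsupport φ) : zeroExt Ω φ x = 0 := by
  by_cases hxΩ : x ∈ Ω.carrier
  · have := zeroExt_apply_mem Ω φ ⟨x, hxΩ⟩
    simp only at this
    rw [this]
    apply image_eq_zero_of_notMem_tsupport
    intro h
    exact hx ⟨_, h, rfl⟩
  · exact zeroExt_apply_notMem Ω _ hxΩ

theorem isCompact_image_tsupport (Ω : BddOpen d) (φ : C_c(Ω, ℝ)) :
    IsCompact (Subtype.val '' tsupport φ : Set (Eucl d)) :=
  φ.hasCompactSupport.isCompact.image continuous_subtype_val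

theorem continuous_zeroExt (Ω : BddOpen d) (φ : C_c(Ω, ℝ)) : Continuous (zeroExt Ω φ) := by
  rw [continuous_iff_continuousAt]
  intro x
  by_cases hx : x ∈ Ω.carrier
  · refine (Ω.isOpen.isOpenEmbedding_subtypeVal.continuousAt_iff (g := zeroExt Ω φ)
      (x := ⟨x, hx⟩)).1 ?_
    have : zeroExt Ω φ ∘ Subtype.val = φ := by
      funext y
      exact zeroExt_apply_mem Ω φ y
    rw [this]
    exact φ.continuous.continuousAt
  · have hK := (isCompact_image_tsupport Ω φ).isClosed.isOpen_compl
    have hxK : x ∈ (Subtype.val '' tsupport φ : Set (Eucl d))ᶜ := by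
      rintro ⟨a, -, rfl⟩
      exact hx a.2
    have : zeroExt Ω φ =ᶠ[𝓝 x] fun _ => 0 := by
      filter_upwards [hK.mem_nhds hxK] with z hz
      exact zeroExt_eq_zero Ω φ hz
    exact continuousAt_const.congr this.symm

theorem hasCompactSupport_zeroExt (Ω : BddOpen d) (φ : C_c(Ω, ℝ)) :
    HasCompactSupport (zeroExt Ω φ) :=
  HasCompactSupport.intro (isCompact_image_tsupport Ω φ) fun _ hx => zeroExt_eq_zero Ω φ hx

theorem exists_bound (Ω : BddOpen d) (φ : C_c(Ω, ℝ)) :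
    ∃ C : ℝ, 0 ≤ C ∧ ∀ x, ‖zeroExt Ω φ x‖ ≤ C := by
  obtain ⟨C, hC⟩ := (continuous_zeroExt Ω φ).bounded_above_of_compact_support
    (hasCompactSupport_zeroExt Ω φ)
  exact ⟨C, (norm_nonneg _).trans (hC 0), hC⟩

/-- The space `C₀(Ω)` of continuous functions on `Ω` vanishing at infinity (the closure of `C_c(Ω)`
in the uniform norm), with the uniform norm. It is Mathlib's `C₀(Ω, ℝ)` under a name of its own, so
that all algebraic instances are derived from the normed space structure. -/
def C0 (Ω : BddOpen d) : Type := C₀(Ω, ℝ)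

instance (Ω : BddOpen d) : NormedAddCommGroup (C0 Ω) :=
  inferInstanceAs (NormedAddCommGroup C₀(Ω, ℝ))

instance (Ω : BddOpen d) : NormedSpace ℝ (C0 Ω) :=
  inferInstanceAs (NormedSpace ℝ C₀(Ω, ℝ))

instance (Ω : BddOpen d) : FunLike (C0 Ω) Ω ℝ :=
  inferInstanceAs (FunLike C₀(Ω, ℝ) Ω ℝ)

instance (Ω : BddOpen d) : ZeroAtInftyContinuousMapClass (C0 Ω) Ω ℝ :=
  inferInstanceAs (ZeroAtInftyContinuousMapClass C₀(Ω, ℝ) Ω ℝ)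

namespace C0

variable {Ω : BddOpen d}

@[ext] theorem ext {φ ψ : C0 Ω} (h : ∀ x, φ x = ψ x) : φ = ψ := DFunLike.ext φ ψ h

theorem coe_add (φ ψ : C0 Ω) : ⇑(φ + ψ) = ⇑φ + ⇑ψ := rfl

theorem coe_smul (c : ℝ) (φ : C0 Ω) : ⇑(c • φ) = c • ⇑φ := rfl

theorem norm_coe_le_norm (φ : C0 Ω) (x : Ω) : ‖φ x‖ ≤ ‖φ‖ :=
  BoundedContinuousFunction.norm_coe_le_norm (ZeroAtInftyContinuousMap.toBCF (show C₀(Ω, ℝ) from φ)) x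

theorem norm_le {φ : C0 Ω} {C : ℝ} (hC : 0 ≤ C) : ‖φ‖ ≤ C ↔ ∀ x, ‖φ x‖ ≤ C :=
  BoundedContinuousFunction.norm_le (f := ZeroAtInftyContinuousMap.toBCF (show C₀(Ω, ℝ) from φ)) hC

end C0

/-- The space `𝓜(Ω)` of finite Radon measures, as the dual of `C₀(Ω)` with the dual norm. -/
abbrev RadonMeasure (Ω : BddOpen d) : Type := StrongDual ℝ (C0 Ω)

/-- `L^q(Ω)`. -/
abbrev LpOn (q : ℝ≥0∞) (Ω : BddOpen d) : Type := Lp ℝ q Ω.vol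

theorem integrable_of_Lp {q : ℝ≥0∞} [hq : Fact (1 ≤ q)] (Ω : BddOpen d) (w : LpOn q Ω) :
    Integrable w Ω.vol := (Lp.memLp w).integrable hq.out

theorem integrable_mul_bdd (Ω : BddOpen d) {g f : Eucl d → ℝ} (hg : Integrable g Ω.vol)
    (hf : Measurable f) {C : ℝ} (hC : ∀ x, ‖f x‖ ≤ C) : Integrable (fun x => f x * g x) Ω.vol :=
  hg.bdd_mul hf.aestronglyMeasurable (Eventually.of_forall hC)

theorem continuous_corrFun (Ω S : BddOpen d) (g : LpOn 2 S) (φ : C_c(Ω, ℝ)) :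
    Continuous fun y : Ω.sub S => ∫ x, zeroExt Ω φ (x + y) * g x ∂S.vol := by
  obtain ⟨C, -, hC⟩ := exists_bound Ω φ
  have hφ := continuous_zeroExt Ω φ
  refine continuous_of_dominated (bound := fun x => C * ‖g x‖) ?_ ?_ ?_ ?_
  · intro y
    exact ((hφ.comp (continuous_id.add continuous_const)).aestronglyMeasurable).mul
      (Lp.aestronglyMeasurable g)
  · intro y
    refine Eventually.of_forall fun x => ?_
    rw [norm_mul]
    gcongr
    exact hC _
  · exact (integrable_of_Lp S g).norm.const_mul C
  · exact Eventually.of_forall fun x =>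
      (hφ.comp (continuous_const.add continuous_subtype_val)).mul continuous_const

theorem corrFun_tendsto (Ω S : BddOpen d) (g : LpOn 2 S) (φ : C_c(Ω, ℝ)) :
    Tendsto (fun y : Ω.sub S => ∫ x, zeroExt Ω φ (x + y) * g x ∂S.vol)
      (cocompact (Ω.sub S)) (𝓝 0) := by
  apply HasCompactSupport.is_zero_at_infty
  set K : Set (Eucl d) := Subtype.val '' tsupport φ
  have hK : IsCompact K := isCompact_image_tsupport Ω φ
  have hKΩ : K ⊆ Ω.carrier := by
    rintro _ ⟨a, -, rfl⟩
    exact a.2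
  have hcl : IsCompact (closure S.carrier) := S.isBounded.isCompact_closure
  have hsub : K - closure S.carrier ⊆ (Ω.sub S).carrier := by
    have := Ω.isOpen.sub_closure S.carrier
    exact (Set.sub_subset_sub_right hKΩ).trans this.subset
  have hT : IsCompact (Subtype.val ⁻¹' (K - closure S.carrier) : Set (Ω.sub S)) :=
    (Topology.IsInducing.subtypeVal.isCompact_preimage_iff (by simpa using hsub)).2
      (by simpa [Set.sub_image_prod] using (hK.prod hcl).image continuous_sub)
  refine HasCompactSupport.intro hT fun y hy => ?_
  have : ∀ᵐ x ∂S.vol, zeroExt Ω φ (x + y) * g x = 0 := by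
    filter_upwards [ae_restrict_mem S.isOpen.measurableSet] with x hx
    rw [zeroExt_eq_zero, zero_mul]
    intro hxy
    exact hy ⟨x + y, hxy, x, subset_closure hx, by simp⟩
  simpa using integral_congr_ae this

/-- The function `y ↦ ∫_S φ̃(x + y) g(x) dx` on `Ω - S`, an element of `C₀(Ω - S)`. -/
def corr (Ω S : BddOpen d) (g : LpOn 2 S) (φ : C_c(Ω, ℝ)) : C0 (Ω.sub S) :=
  (⟨⟨fun y => ∫ x, zeroExt Ω φ (x + y) * g x ∂S.vol, continuous_corrFun Ω S g φ⟩,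
    corrFun_tendsto Ω S g φ⟩ : C₀(Ω.sub S, ℝ))

theorem corr_apply (Ω S : BddOpen d) (g : LpOn 2 S) (φ : C_c(Ω, ℝ)) (y : Ω.sub S) :
    corr Ω S g φ y = ∫ x, zeroExt Ω φ (x + y) * g x ∂S.vol := rfl

/-- An integrable function on `Ω` whose integral against every element of `C_c(Ω)` vanishes is zero. -/
theorem ae_eq_zero_of_forall_test (Ω : BddOpen d) {f : Eucl d → ℝ} (hf : Integrable f Ω.vol)
    (h : ∀ φ : C_c(Ω, ℝ), ∫ x, f x * zeroExt Ω φ x ∂Ω.vol = 0) : f =ᵐ[Ω.vol] 0 := by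
  have key := Ω.isOpen.ae_eq_zero_of_integral_contDiff_smul_eq_zero (μ := volume) (f := f)
    (IntegrableOn.locallyIntegrableOn hf) ?_
  · exact (ae_restrict_iff' Ω.isOpen.measurableSet).2 key
  · intro ψ hψ hψc hψs
    let φ : C_c(Ω, ℝ) := ⟨⟨fun x => ψ x, hψ.continuous.comp continuous_subtype_val⟩, by
      have hT : IsCompact (Subtype.val ⁻¹' (tsupport ψ) : Set Ω) :=
        (Topology.IsInducing.subtypeVal.isCompact_preimage_iff (by simpa using hψs)).2 hψc
      exact HasCompactSupport.intro hT fun y hy =>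
        image_eq_zero_of_notMem_tsupport (f := ψ) hy⟩
    have hext : zeroExt Ω φ = ψ := by
      funext x
      by_cases hx : x ∈ Ω.carrier
      · exact zeroExt_apply_mem Ω φ ⟨x, hx⟩
      · rw [zeroExt_apply_notMem Ω _ hx]
        exact (image_eq_zero_of_notMem_tsupport fun hx' => hx (hψs hx')).symm
    have h1 := h φ
    rw [hext] at h1
    rw [← h1]
    rw [setIntegral_eq_integral_of_forall_compl_eq_zero]
    · simp [mul_comm]
    · intro x hx
      rw [image_eq_zero_of_notMem_tsupport fun hx' => hx (hψs hx'), mul_zero]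

/-- Test functions belong to `L^p(Ω)`. -/
theorem memLp_zeroExt (Ω : BddOpen d) (p : ℝ≥0∞) (φ : C_c(Ω, ℝ)) :
    MemLp (zeroExt Ω φ) p Ω.vol :=
  ((continuous_zeroExt Ω φ).memLp_of_hasCompactSupport (hasCompactSupport_zeroExt Ω φ)).restrict _

theorem norm_corr_le (Ω S : BddOpen d) (g : LpOn 2 S) (φ : C_c(Ω, ℝ)) (y : Ω.sub S) :
    ‖corr Ω S g φ y‖ ≤ ‖(memLp_zeroExt Ω 2 φ).toLp‖ * ‖g‖ := by
  have hφ := continuous_zeroExt Ω φ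
  have hvol : MemLp (zeroExt Ω φ) 2 volume :=
    hφ.memLp_of_hasCompactSupport (hasCompactSupport_zeroExt Ω φ)
  have hmp := measurePreserving_add_right (volume : Measure (Eucl d)) (y : Eucl d)
  have hshift : MemLp (fun x => zeroExt Ω φ (x + y)) 2 volume := hvol.comp_measurePreserving hmp
  have hS : MemLp (fun x => zeroExt Ω φ (x + y)) 2 S.vol := hshift.restrict _
  have h1 : ‖hS.toLp‖ ≤ ‖(memLp_zeroExt Ω 2 φ).toLp‖ := by
    rw [Lp.norm_toLp, Lp.norm_toLp]
    refine ENNReal.toReal_mono (memLp_zeroExt Ω 2 φ).eLpNorm_ne_top ?_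
    calc eLpNorm (fun x => zeroExt Ω φ (x + y)) 2 S.vol
        ≤ eLpNorm (fun x => zeroExt Ω φ (x + y)) 2 volume := eLpNorm_restrict_le _ _ _ _
      _ = eLpNorm (zeroExt Ω φ) 2 volume :=
          eLpNorm_comp_measurePreserving hvol.aestronglyMeasurable hmp
      _ = eLpNorm (zeroExt Ω φ) 2 Ω.vol := by
          refine (eLpNorm_restrict_eq_of_support_subset fun x hx => ?_).symm
          by_contra hxΩ
          exact hx (zeroExt_apply_notMem Ω _ hxΩ)
  have h2 : corr Ω S g φ y = inner ℝ g hS.toLp := by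
    rw [L2.inner_def]
    refine integral_congr_ae ?_
    filter_upwards [hS.coeFn_toLp] with x hx
    rw [hx]
    rfl
  rw [h2]
  calc ‖inner ℝ g hS.toLp‖ ≤ ‖g‖ * ‖hS.toLp‖ := norm_inner_le_norm _ _
    _ ≤ ‖g‖ * ‖(memLp_zeroExt Ω 2 φ).toLp‖ := by gcongr
    _ = _ := mul_comm _ _

theorem integrable_corr (Ω S : BddOpen d) (g : LpOn 2 S) (φ : C_c(Ω, ℝ)) (y : Eucl d) :
    Integrable (fun x => zeroExt Ω φ (x + y) * g x) S.vol := by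
  obtain ⟨C, -, hC⟩ := exists_bound Ω φ
  exact integrable_mul_bdd S (integrable_of_Lp S g)
    ((continuous_zeroExt Ω φ).comp (continuous_id.add continuous_const)).measurable
    fun x => hC (x + y)

theorem corr_add (Ω S : BddOpen d) (g : LpOn 2 S) (φ ψ : C_c(Ω, ℝ)) :
    corr Ω S g (φ + ψ) = corr Ω S g φ + corr Ω S g ψ := by
  ext y
  rw [corr_apply]
  change ∫ x, zeroExt Ω (⇑φ + ⇑ψ) (x + y) * g x ∂S.vol = _
  simp only [zeroExt_add, add_mul]
  exact integral_add (integrable_corr Ω S g φ y) (integrable_corr Ω S g ψ y)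

theorem corr_smul (Ω S : BddOpen d) (g : LpOn 2 S) (c : ℝ) (φ : C_c(Ω, ℝ)) :
    corr Ω S g (c • φ) = c • corr Ω S g φ := by
  ext y
  rw [corr_apply]
  change ∫ x, zeroExt Ω (c • ⇑φ) (x + y) * g x ∂S.vol = _
  simp only [zeroExt_smul, mul_assoc]
  exact integral_const_mul c _

/-- The inclusion of `C_c(Ω)` into `L²(Ω)`. -/
def testToL2 (Ω : BddOpen d) : C_c(Ω, ℝ) →ₗ[ℝ] LpOn 2 Ω where
  toFun φ := (memLp_zeroExt Ω 2 φ).toLp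
  map_add' φ ψ := by
    rw [← MemLp.toLp_add]
    exact MemLp.toLp_congr _ _ (Eventually.of_forall fun x => zeroExt_add Ω φ ψ x)
  map_smul' c φ := by
    rw [RingHom.id_apply, ← MemLp.toLp_const_smul]
    exact MemLp.toLp_congr _ _ (Eventually.of_forall fun x => zeroExt_smul Ω c φ x)

theorem inner_testToL2 (Ω : BddOpen d) (w : LpOn 2 Ω) (φ : C_c(Ω, ℝ)) :
    inner ℝ w (testToL2 Ω φ) = ∫ x, w x * zeroExt Ω φ x ∂Ω.vol := by
  rw [L2.inner_def]
  refine integral_congr_ae ?_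
  filter_upwards [(memLp_zeroExt Ω 2 φ).coeFn_toLp] with x hx
  change inner ℝ (w x) (((memLp_zeroExt Ω 2 φ).toLp : LpOn 2 Ω) x) = _
  rw [hx]
  exact mul_comm _ _

theorem denseRange_testToL2 (Ω : BddOpen d) : DenseRange (testToL2 Ω) := by
  have h : (LinearMap.range (testToL2 Ω)).topologicalClosure = ⊤ := by
    rw [Submodule.topologicalClosure_eq_top_iff, Submodule.eq_bot_iff]
    intro w hw
    have := ae_eq_zero_of_forall_test Ω (integrable_of_Lp Ω w) fun φ => by
      rw [← inner_testToL2]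
      exact (Submodule.mem_orthogonal' _ _).1 hw _ ⟨φ, rfl⟩
    exact (Lp.eq_zero_iff_ae_eq_zero).2 this
  have h2 := (Submodule.dense_iff_topologicalClosure_eq_top).2 h
  rwa [LinearMap.coe_range] at h2

/-- Well-definedness of the convolution of a Radon measure on `Ω - S` with a kernel in `L²(S)`. -/
theorem existsUnique_conv {q : ℝ≥0∞} [Fact (1 ≤ q)] (hq : q ≤ 2) {Ω S : BddOpen d}
    (μ : RadonMeasure (Ω.sub S)) (g : LpOn 2 S) :
    ∃! w : LpOn q Ω, ∀ φ : C_c(Ω, ℝ),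
      ∫ x, w x * zeroExt Ω φ x ∂Ω.vol = μ (corr Ω S g φ) := by
  let f : C_c(Ω, ℝ) →ₗ[ℝ] ℝ :=
    { toFun := fun φ => μ (corr Ω S g φ)
      map_add' := fun φ ψ => by rw [corr_add, map_add]
      map_smul' := fun c φ => by rw [corr_smul, map_smul]; rfl }
  have hdense := denseRange_testToL2 Ω
  have hbound : ∀ φ, ‖f φ‖ ≤ (‖μ‖ * ‖g‖) * ‖testToL2 Ω φ‖ := by
    intro φ
    calc ‖μ (corr Ω S g φ)‖ ≤ ‖μ‖ * ‖corr Ω S g φ‖ := μ.le_opNorm _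
      _ ≤ ‖μ‖ * (‖(memLp_zeroExt Ω 2 φ).toLp‖ * ‖g‖) := by
          gcongr
          exact (C0.norm_le (by positivity)).2 (norm_corr_le Ω S g φ)
      _ = _ := by change _ = (‖μ‖ * ‖g‖) * ‖(memLp_zeroExt Ω 2 φ).toLp‖; ring
  let ℓ : StrongDual ℝ (LpOn 2 Ω) := f.extendOfNorm (testToL2 Ω)
  let w₂ : LpOn 2 Ω := (InnerProductSpace.toDual ℝ (LpOn 2 Ω)).symm ℓ
  have hw₂ : ∀ φ : C_c(Ω, ℝ), ∫ x, w₂ x * zeroExt Ω φ x ∂Ω.vol = μ (corr Ω S g φ) := by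
    intro φ
    rw [← inner_testToL2, InnerProductSpace.toDual_symm_apply]
    exact LinearMap.extendOfNorm_eq hdense ⟨_, hbound⟩ φ
  have hmem : MemLp w₂ q Ω.vol := (Lp.memLp w₂).mono_exponent hq
  have hw : ∀ φ : C_c(Ω, ℝ),
      ∫ x, hmem.toLp w₂ x * zeroExt Ω φ x ∂Ω.vol = μ (corr Ω S g φ) := by
    intro φ
    rw [← hw₂ φ]
    refine integral_congr_ae ?_
    filter_upwards [hmem.coeFn_toLp] with x hx
    rw [hx]
  refine ⟨hmem.toLp w₂, hw, fun w' hw' => ?_⟩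
  rw [← sub_eq_zero, Lp.eq_zero_iff_ae_eq_zero]
  refine ae_eq_zero_of_forall_test Ω (integrable_of_Lp Ω _) fun φ => ?_
  obtain ⟨C, -, hC⟩ := exists_bound Ω φ
  have hint : ∀ v : LpOn q Ω, Integrable (fun x => v x * zeroExt Ω φ x) Ω.vol := fun v => by
    simpa only [mul_comm] using integrable_mul_bdd Ω (integrable_of_Lp Ω v)
      (continuous_zeroExt Ω φ).measurable hC
  have h1 : ∫ x, (w' - hmem.toLp w₂ : LpOn q Ω) x * zeroExt Ω φ x ∂Ω.vol
      = ∫ x, (w' x * zeroExt Ω φ x - hmem.toLp w₂ x * zeroExt Ω φ x) ∂Ω.vol := by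
    refine integral_congr_ae ?_
    filter_upwards [Lp.coeFn_sub w' (hmem.toLp w₂)] with x hx
    rw [hx, Pi.sub_apply, sub_mul]
  rw [h1, integral_sub (hint _) (hint _), hw', hw, sub_self]

/-- The convolution `μ * g ∈ L^q(Ω)` of `μ ∈ 𝓜(Ω - S)` and `g ∈ L²(S)`: the unique element of
`L^q(Ω)` with `∫_Ω (μ * g) φ dx = ∫_{Ω - S} ∫_S φ̃(x + y) g(x) dx dμ(y)` for all `φ ∈ C_c(Ω)`. -/
def conv {q : ℝ≥0∞} [Fact (1 ≤ q)] (hq : q ≤ 2) {Ω S : BddOpen d}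
    (μ : RadonMeasure (Ω.sub S)) (g : LpOn 2 S) : LpOn q Ω :=
  (existsUnique_conv hq μ g).choose

theorem conv_spec {q : ℝ≥0∞} [Fact (1 ≤ q)] (hq : q ≤ 2) {Ω S : BddOpen d}
    (μ : RadonMeasure (Ω.sub S)) (g : LpOn 2 S) (φ : C_c(Ω, ℝ)) :
    ∫ x, conv hq μ g x * zeroExt Ω φ x ∂Ω.vol = μ (corr Ω S g φ) :=
  (existsUnique_conv hq μ g).choose_spec.1 φ

/-- The identification of `w ∈ L^q(Ω)` with the measure `φ ↦ ∫_Ω w φ dx` in `𝓜(Ω)`. -/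
def toMeasure {q : ℝ≥0∞} [Fact (1 ≤ q)] {Ω : BddOpen d} (w : LpOn q Ω) : RadonMeasure Ω :=
  LinearMap.mkContinuous
    { toFun := fun φ : C0 Ω => ∫ x, w x * zeroExt Ω φ x ∂Ω.vol
      map_add' := fun φ ψ => by
        have hint : ∀ φ : C0 Ω, Integrable (fun x => w x * zeroExt Ω φ x) Ω.vol := fun φ => by
          have h := integrable_mul_bdd Ω (integrable_of_Lp Ω w)
            (measurable_zeroExt Ω (map_continuous φ))
            (norm_zeroExt_le Ω (norm_nonneg φ) φ.norm_coe_le_norm)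
          simpa only [mul_comm] using h
        rw [← integral_add (hint φ) (hint ψ)]
        refine integral_congr_ae (Eventually.of_forall fun x => ?_)
        simp only [C0.coe_add, zeroExt_add, mul_add]
      map_smul' := fun c φ => by
        rw [RingHom.id_apply, smul_eq_mul, ← integral_const_mul]
        refine integral_congr_ae (Eventually.of_forall fun x => ?_)
        simp only [C0.coe_smul, zeroExt_smul]
        ring }
    (∫ x, ‖w x‖ ∂Ω.vol) fun φ => by
      change ‖∫ x, w x * zeroExt Ω φ x ∂Ω.vol‖ ≤ _
      rw [← integral_mul_const]
      refine norm_integral_le_of_norm_le ((integrable_of_Lp Ω w).norm.mul_const _)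
        (Eventually.of_forall fun x => ?_)
      rw [norm_mul]
      gcongr
      exact norm_zeroExt_le Ω (norm_nonneg φ) φ.norm_coe_le_norm x

/-- The `k`-th component of the vectorial convolution of measures `μ_n` on `Ω - S` with kernels
`θ_{n,k}`, `(n, k) ∈ E`: the sum of `μ_n * θ_{n,k} ∈ L^q(Ω)` over all `n` with `(n, k) ∈ E`. -/
def layerConv {q : ℝ≥0∞} [Fact (1 ≤ q)] (hq : q ≤ 2) {Ω S : BddOpen d} {N N' : ℕ}
    {E : Finset (Fin N × Fin N')} (μ : Fin N → RadonMeasure (Ω.sub S)) (θ : E → LpOn 2 S)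
    (k : Fin N') : LpOn q Ω :=
  ∑ e : E, if e.1.2 = k then conv hq (μ e.1.1) (θ e) else 0

/-- The domains `Ω⁰ = Ω`, `Ω^{l+1} = Ω^l - S`. -/
def dom (Ω S : BddOpen d) : ℕ → BddOpen d
  | 0 => Ω
  | l + 1 => (dom Ω S l).sub S

/-- A network architecture with layers `1, …, depth`, where `width l` is the number `N_l` of
variables in layer `l` (only the values for `l ≤ depth` matter, and `N₀ = 1`).
Layers are stored with index shifted by one: for `l < depth`, `edges l` is the set `E^{l+1}` of
connections `(n, k)` between variable `n` of layer `l + 1` and variable `k` of layer `l`. -/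
structure Architecture where
  depth : ℕ
  depth_pos : 0 < depth
  width : ℕ → ℕ
  width_zero : width 0 = 1
  edges : (l : Fin depth) → Finset (Fin (width (l + 1)) × Fin (width l))
  connected : ∀ (l : Fin depth) (n : Fin (width (l + 1))), ∃ k : Fin (width l), (n, k) ∈ edges l

/-- The space `M^{l+1} = 𝓜(Ω^{l+1})^{N_{l+1}}`. -/
abbrev LayerLatent (a : Architecture) (Ω S : BddOpen d) (l : ℕ) : Type :=
  Fin (a.width (l + 1)) → RadonMeasure (dom Ω S (l + 1))

/-- The latent variables `μ = (μ¹, …, μ^L)`, with `μ^{l+1}` stored at index `l`. -/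
abbrev Latent (a : Architecture) (Ω S : BddOpen d) : Type :=
  (l : Fin a.depth) → LayerLatent a Ω S l

/-- The filter kernels `θ = (θ¹, …, θ^L)`, with `θ^{l+1} ∈ L²(S)^{E^{l+1}}` stored at index `l`. -/
abbrev Kernels (a : Architecture) (S : BddOpen d) : Type :=
  (l : Fin a.depth) → a.edges l → LpOn 2 S

/-- The constraints on `(μ, θ)` in the definition of the generative prior at `v`. -/
structure Feasible {q : ℝ≥0∞} [Fact (1 ≤ q)] (hq : q ≤ 2) {a : Architecture} {Ω S : BddOpen d}
    {Nc : ℕ} (Z : Kernels a S →L[ℝ] EuclideanSpace ℝ (Fin Nc)) (v : LpOn q Ω)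
    (μ : Latent a Ω S) (θ : Kernels a S) : Prop where
  output : v = layerConv hq (μ ⟨0, a.depth_pos⟩) (θ ⟨0, a.depth_pos⟩)
    ⟨0, a.width_zero ▸ Nat.one_pos⟩
  norm_le : ∀ l e, ‖θ l e‖ ≤ 1
  linear : Z θ = 0

/-- The penalties `J_1, …, J_{L-1}`, with `J_{l+1} : M^{l+1} → [0, ∞]` stored at index `l`. -/
abbrev Penalties (a : Architecture) (Ω S : BddOpen d) : Type :=
  (l : Fin (a.depth - 1)) → LayerLatent a Ω S l → ℝ≥0∞

/-- The cost `‖μ‖_𝓜 + ∑_{l=2}^L J_{l-1}(μ^{l-1} - μ^l *_l θ^l)`; the summand at `i` is the one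
with `l = i + 2`. -/
def cost {q : ℝ≥0∞} [Fact (1 ≤ q)] (hq : q ≤ 2) {a : Architecture} {Ω S : BddOpen d}
    (J : Penalties a Ω S) (μ : Latent a Ω S) (θ : Kernels a S) : ℝ≥0∞ :=
  (∑ l, ∑ n, ENNReal.ofReal ‖μ l n‖) +
    ∑ i : Fin (a.depth - 1), J i fun k =>
      μ ⟨i, by omega⟩ k -
        toMeasure (layerConv hq (Ω := dom Ω S (i + 1)) (μ ⟨i + 1, by omega⟩) (θ ⟨i + 1, by omega⟩) k)

/-- The generative prior; it equals `∞` if no `(μ, θ)` is feasible. -/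
def genPrior {q : ℝ≥0∞} [Fact (1 ≤ q)] (hq : q ≤ 2) {a : Architecture} {Ω S : BddOpen d}
    (J : Penalties a Ω S) {Nc : ℕ} (Z : Kernels a S →L[ℝ] EuclideanSpace ℝ (Fin Nc))
    (v : LpOn q Ω) : ℝ≥0∞ :=
  ⨅ (μ : Latent a Ω S) (θ : Kernels a S) (_ : Feasible hq Z v μ θ), cost hq J μ θ

/-- Weak* (sequential) lower semicontinuity on `M^{l+1}`, with componentwise weak* convergence. -/
def WeakStarLSC {a : Architecture} {Ω S : BddOpen d} {l : ℕ}
    (F : LayerLatent a Ω S l → ℝ≥0∞) : Prop :=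
  ∀ (μ : ℕ → LayerLatent a Ω S l) (μ₀ : LayerLatent a Ω S l),
    (∀ n (φ : C0 (dom Ω S (l + 1))), Tendsto (fun m => μ m n φ) atTop (𝓝 (μ₀ n φ))) →
      F μ₀ ≤ liminf (fun m => F (μ m)) atTop

/-- Weak (sequential) lower semicontinuity on a normed space. -/
def WeakLSC {X : Type*} [NormedAddCommGroup X] [NormedSpace ℝ X] (F : X → ℝ≥0∞) : Prop :=
  ∀ (x : ℕ → X) (x₀ : X),
    (∀ f : StrongDual ℝ X, Tendsto (fun m => f (x m)) atTop (𝓝 (f x₀))) →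
      F x₀ ≤ liminf (fun m => F (x m)) atTop

/-- `F` is finite somewhere. -/
def Proper {X : Type*} (F : X → ℝ≥0∞) : Prop := ∃ x, F x < ∞

/-- `F x → ∞` as `‖x‖ → ∞`. -/
def Coercive {X : Type*} [NormedAddCommGroup X] (F : X → ℝ≥0∞) : Prop :=
  Tendsto F (comap norm atTop) (𝓝 ∞)

def sR (ν : ℝ) : ℝ := ν / min ν (1 - ν)

def sG (ν : ℝ) : ℝ := (1 - ν) / min ν (1 - ν)

/-- The energy `(u, v) ↦ λ D(A u) + s_R(ν) R(u - v) + s_G(ν) G(v)`. -/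
def energy {X Y : Type*} [Sub X] (lam ν : ℝ) (D : Y → ℝ≥0∞) (A : X → Y) (R G : X → ℝ≥0∞)
    (u v : X) : ℝ≥0∞ :=
  ENNReal.ofReal lam * D (A u) + ENNReal.ofReal (sR ν) * R (u - v) + ENNReal.ofReal (sG ν) * G v

end GenPrior

end

/-! The direct method works on tuples `(u, μ, θ)` rather than on pairs `(u, v)`, with `v` read off
as the network output. The infimum over `v` and the infimum inside the generative prior then merge
into one, so a minimizing tuple yields a minimizing pair and attainment of the prior needs no
separate treatment.

Compactness: bounded energy bounds the masses of all latent measures, and the kernels lie in unit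
balls. Sequential Banach-Alaoglu in the dual of the separable space `C0` and weak compactness in L²
give convergent parameters. The component `u` need not be bounded, since `R` controls it only modulo
`U` and `D` sees only `A u`. Neither changes when the part of `u` in `U ∩ ker A` is altered; as `A`
is bounded below on a complement of `U ∩ ker A` in `U`, a suitable shift is bounded
(`exists_bounded_shift`). Weak compactness in L^q is derived from uniform convexity
(`uniformConvexSpace_Lp`, `exists_subseq_weakTendsto`), without identifying the dual.

Closedness: the convolution is bilinear and both factors converge only weakly. Tested against `φ`,
however, the kernel enters through its correlation with `φ`, and weak convergence of kernels makes
these correlations converge uniformly (`WeakTendsto.tendsto_corr`). Uniform convergence pairs with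
weak* convergence of measures, so convolutions converge weakly (`weakTendsto_conv`). Constraints and
penalties then pass to the limit, and convexity makes `D` weakly lower semicontinuous. -/

namespace GenPrior

/-! ### Weak sequential convergence. -/

section WeakConvergence

variable {X X' : Type*} [NormedAddCommGroup X] [NormedSpace ℝ X]
  [NormedAddCommGroup X'] [NormedSpace ℝ X']

/-- Weak convergence of a sequence in a normed space. -/
def WeakTendsto (x : ℕ → X) (x₀ : X) : Prop :=
  ∀ f : StrongDual ℝ X, Tendsto (fun m => f (x m)) atTop (𝓝 (f x₀))

namespace WeakTendsto

theorem const (x₀ : X) : WeakTendsto (fun _ => x₀) x₀ := fun _ => tendsto_const_nhds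

theorem map {x : ℕ → X} {x₀ : X} (h : WeakTendsto x x₀) (T : X →L[ℝ] X') :
    WeakTendsto (fun m => T (x m)) (T x₀) := fun f => h (f.comp T)

theorem add {x y : ℕ → X} {x₀ y₀ : X} (hx : WeakTendsto x x₀) (hy : WeakTendsto y y₀) :
    WeakTendsto (fun m => x m + y m) (x₀ + y₀) := fun f => by
  simpa only [map_add] using (hx f).add (hy f)

theorem sub {x y : ℕ → X} {x₀ y₀ : X} (hx : WeakTendsto x x₀) (hy : WeakTendsto y y₀) :
    WeakTendsto (fun m => x m - y m) (x₀ - y₀) := fun f => by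
  simpa only [map_sub] using (hx f).sub (hy f)

theorem sum {ι : Type*} (s : Finset ι) {x : ι → ℕ → X} {x₀ : ι → X}
    (h : ∀ i ∈ s, WeakTendsto (x i) (x₀ i)) :
    WeakTendsto (fun m => ∑ i ∈ s, x i m) (∑ i ∈ s, x₀ i) := fun f => by
  simpa only [map_sum] using tendsto_finsetSum s fun i hi => h i hi f

theorem comp {x : ℕ → X} {x₀ : X} (h : WeakTendsto x x₀) {φ : ℕ → ℕ} (hφ : StrictMono φ) :
    WeakTendsto (x ∘ φ) x₀ := fun f => (h f).comp hφ.tendsto_atTop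

theorem pi {ι : Type*} [Fintype ι] {E : ι → Type*} [∀ i, NormedAddCommGroup (E i)]
    [∀ i, NormedSpace ℝ (E i)] {x : ℕ → (i : ι) → E i} {x₀ : (i : ι) → E i}
    (h : ∀ i, WeakTendsto (fun m => x m i) (x₀ i)) : WeakTendsto x x₀ := by
  classical
  have hsum : ∀ y : (i : ι) → E i, ∑ i, ContinuousLinearMap.single ℝ E i (y i) = y :=
    fun y => Finset.univ_sum_single y
  have := WeakTendsto.sum Finset.univ fun i _ => (h i).map (ContinuousLinearMap.single ℝ E i)
  simpa only [hsum] using this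

/-- Closed convex sets are weakly sequentially closed. -/
theorem mem_of_frequently_mem {x : ℕ → X} {x₀ : X} (h : WeakTendsto x x₀) {C : Set X}
    (hconv : Convex ℝ C) (hclosed : IsClosed C) (hC : ∃ᶠ m in atTop, x m ∈ C) : x₀ ∈ C := by
  by_contra hx
  obtain ⟨f, r, hf, hr⟩ := geometric_hahn_banach_closed_point hconv hclosed hx
  obtain ⟨m, hm, hm'⟩ := (hC.and_eventually ((h f).eventually_const_lt hr)).exists
  exact (hf _ hm).not_gt hm'

theorem mem_of_forall_mem {x : ℕ → X} {x₀ : X} (h : WeakTendsto x x₀) {C : Set X}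
    (hconv : Convex ℝ C) (hclosed : IsClosed C) (hC : ∀ m, x m ∈ C) : x₀ ∈ C :=
  h.mem_of_frequently_mem hconv hclosed (Frequently.of_forall hC)

theorem norm_le {x : ℕ → X} {x₀ : X} (h : WeakTendsto x x₀) {r : ℝ} (hr : ∀ m, ‖x m‖ ≤ r) :
    ‖x₀‖ ≤ r := by
  have := h.mem_of_forall_mem (convex_closedBall (0 : X) r) Metric.isClosed_closedBall
    fun m => mem_closedBall_zero_iff.2 (hr m)
  exact mem_closedBall_zero_iff.1 this

end WeakTendsto

end WeakConvergence

/-! ### Closed convex hulls of tails. -/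

section TailHulls

variable {E : Type*} [NormedAddCommGroup E] [NormedSpace ℝ E]

/-- A point common to the closed convex hulls of all tails serves as a weak cluster point: a closed
half-space containing some tail contains its closed hull. -/
theorem le_of_mem_closure_convexHull_tails {x : ℕ → E} {p : E}
    (hp : ∀ n, p ∈ closure (convexHull ℝ (x '' Set.Ici n))) (f : StrongDual ℝ E) {c : ℝ}
    (hc : ∀ᶠ m in atTop, c ≤ f (x m)) : c ≤ f p := by
  obtain ⟨N, hN⟩ := eventually_atTop.1 hc
  have hsub : closure (convexHull ℝ (x '' Set.Ici N)) ⊆ {y | c ≤ f y} := by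
    refine closure_minimal (convexHull_min ?_ ?_) (isClosed_le continuous_const f.continuous)
    · rintro _ ⟨m, hm, rfl⟩
      exact hN m hm
    · exact convex_halfSpace_ge f.toLinearMap.isLinear c
  exact hsub (hp N)

theorem eq_of_mem_closure_convexHull_tails {x : ℕ → E} {p : E}
    (hp : ∀ n, p ∈ closure (convexHull ℝ (x '' Set.Ici n))) (f : StrongDual ℝ E) {c : ℝ}
    (hc : Tendsto (fun m => f (x m)) atTop (𝓝 c)) : f p = c := by
  refine le_antisymm (le_of_forall_gt_imp_ge_of_dense fun b hb => ?_)
    (le_of_forall_lt_imp_le_of_dense fun b hb => ?_)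
  · have := le_of_mem_closure_convexHull_tails hp (-f) (c := -b)
      ((hc.eventually_lt_const hb).mono fun m hm => by simpa using hm.le)
    simpa using this
  · exact le_of_mem_closure_convexHull_tails hp f
      ((hc.eventually_const_lt hb).mono fun m hm => hm.le)

/-- A separable normed space has a countable separating family of functionals in the dual ball. -/
theorem exists_separating_functionals [TopologicalSpace.SeparableSpace E] :
    ∃ ℓ : ℕ → StrongDual ℝ E, (∀ i, ‖ℓ i‖ ≤ 1) ∧ ∀ x, (∀ i, ℓ i x = 0) → x = 0 := by
  choose ℓ hℓ hℓ' using fun i => exists_dual_vector'' ℝ (TopologicalSpace.denseSeq E i)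
  refine ⟨ℓ, hℓ, fun x hx => ?_⟩
  by_contra hx0
  obtain ⟨i, hi⟩ := Metric.denseRange_iff.1 (TopologicalSpace.denseRange_denseSeq E) x (‖x‖ / 2)
    (by positivity)
  set y := TopologicalSpace.denseSeq E i
  -- The norming functional of `y` vanishes at `x`, so `x` cannot be closer to `y` than the origin
  -- is.
  have h1 : ‖y‖ ≤ ‖x - y‖ := by
    have : ‖y‖ = -ℓ i (x - y) := by rw [map_sub, hx, hℓ' i]; simp [y]
    rw [this]
    calc -ℓ i (x - y) ≤ ‖ℓ i (x - y)‖ := neg_le_abs _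
      _ ≤ ‖ℓ i‖ * ‖x - y‖ := (ℓ i).le_opNorm _
      _ ≤ 1 * ‖x - y‖ := by gcongr; exact hℓ i
      _ = _ := one_mul _
  have h2 := norm_sub_norm_le x (x - y)
  rw [sub_sub_cancel] at h2
  rw [dist_eq_norm] at hi
  linarith

end TailHulls

/-! ### Weak sequential compactness in uniformly convex spaces. -/

section UniformlyConvex

variable {E : Type*} [NormedAddCommGroup E] [NormedSpace ℝ E] [CompleteSpace E]
  [UniformConvexSpace E]

/-- In a uniformly convex Banach space, nested nonempty closed convex sets with points of bounded
norm have a common point. -/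
theorem exists_forall_mem_of_antitone {C : ℕ → Set E} (hanti : Antitone C)
    (hconv : ∀ n, Convex ℝ (C n)) (hclosed : ∀ n, IsClosed (C n)) {R : ℝ}
    (hne : ∀ n, ∃ x ∈ C n, ‖x‖ ≤ R) : ∃ x, ∀ n, x ∈ C n := by
  have hne' : ∀ n, (C n).Nonempty := fun n => let ⟨x, hx, _⟩ := hne n; ⟨x, hx⟩
  -- Almost nearest points to the origin in `C n` will form a Cauchy sequence.
  let dis : ℕ → ℝ := fun n => Metric.infDist 0 (C n)
  have hmono : Monotone dis := fun m n hmn =>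
    Metric.infDist_le_infDist_of_subset (hanti hmn) (hne' n)
  have hbdd : BddAbove (Set.range dis) := by
    refine ⟨R, ?_⟩
    rintro _ ⟨n, rfl⟩
    obtain ⟨x, hx, hxR⟩ := hne n
    exact (Metric.infDist_le_dist_of_mem hx).trans (by simpa using hxR)
  have hlim := tendsto_atTop_ciSup hmono hbdd
  have hdis_le : ∀ n, dis n ≤ ⨆ i, dis i := le_ciSup hbdd
  set L := ⨆ i, dis i
  have hL0 : 0 ≤ L := Metric.infDist_nonneg.trans (hdis_le 0)
  have hex : ∀ n, ∃ y ∈ C n, dist 0 y < dis n + 1 / ((n : ℝ) + 1) := fun n =>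
    (Metric.infDist_lt_iff (hne' n)).1 (lt_add_of_pos_right _ (by positivity))
  choose p hpC hp using hex
  have hp' : ∀ n, ‖p n‖ ≤ L + 1 / ((n : ℝ) + 1) := fun n => by
    have := hp n
    rw [dist_zero_left] at this
    linarith [hdis_le n]
  have hnorm : ∀ η > 0, ∀ᶠ n in atTop, ‖p n‖ ≤ L + η ∧ L - η < dis n := fun η hη => by
    have h1 := (tendsto_one_div_add_atTop_nhds_zero_nat (𝕜 := ℝ)).eventually_lt_const hη
    filter_upwards [h1, hlim.eventually_const_lt (sub_lt_self L hη)] with n hn hn'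
    exact ⟨(hp' n).trans (by gcongr), hn'⟩
  have hcauchy : CauchySeq p := by
    rw [Metric.cauchySeq_iff]
    intro ε hε
    -- For `L = 0` the points tend to the origin; the convexity argument needs `δ * L > 0`.
    rcases hL0.eq_or_lt with hL | hL
    · obtain ⟨N, hN⟩ := eventually_atTop.1 (hnorm (ε / 4) (by positivity))
      refine ⟨N, fun m hm n hn => ?_⟩
      have := dist_le_norm_add_norm (p m) (p n)
      linarith [(hN m hm).1, (hN n hn).1]
    obtain ⟨δ, hδ, H⟩ := exists_forall_closed_ball_dist_add_le_two_sub E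
      (show 0 < ε / (L + 1) by positivity)
    -- Scaled by `(L + η)⁻¹`, the points lie in the unit ball at distance at least `ε / (L + 1)`.
    -- Their midpoint thus has norm at most `(L + η) * (1 - δ / 2)`, yet it lies in `C N`, at
    -- distance more than `L - η` from the origin. The condition `4 * η ≤ δ * L` makes these
    -- incompatible.
    set η := min 1 (δ * L / 4)
    have hη : 0 < η := by positivity
    obtain ⟨N, hN⟩ := eventually_atTop.1 (hnorm η hη)
    refine ⟨N, fun m hm n hn => ?_⟩
    by_contra! hmn
    set ρ := L + η
    have hρ : 0 < ρ := by positivity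
    have hρ1 : ρ ≤ L + 1 := add_le_add_right (min_le_left _ _) L
    have hscale : ∀ k ≥ N, ‖ρ⁻¹ • p k‖ ≤ 1 := fun k hk => by
      rw [norm_smul, norm_inv, Real.norm_of_nonneg hρ.le, inv_mul_le_one₀ hρ]
      exact (hN k hk).1
    have h1 := H (hscale m hm) (hscale n hn) (by
      rw [← smul_sub, norm_smul, norm_inv, Real.norm_of_nonneg hρ.le, ← dist_eq_norm,
        div_le_iff₀ (by positivity), inv_mul_eq_div, div_mul_eq_mul_div, le_div_iff₀ hρ]
      gcongr)
    rw [← smul_add, norm_smul, norm_inv, Real.norm_of_nonneg hρ.le, inv_mul_le_iff₀ hρ] at h1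
    have hmid : (1 / 2 : ℝ) • p m + (1 / 2 : ℝ) • p n ∈ C N :=
      hconv N (hanti hm (hpC m)) (hanti hn (hpC n)) (by norm_num) (by norm_num) (by norm_num)
    have h2 := Metric.infDist_le_dist_of_mem (x := (0 : E)) hmid
    rw [dist_zero_left, ← smul_add, norm_smul] at h2
    norm_num at h2
    have h3 := (hN N le_rfl).2
    have h4 : η ≤ δ * L / 4 := min_le_right _ _
    change dis N ≤ _ at h2
    have h5 : ρ * (2 - δ) = 2 * L + 2 * η - δ * L - δ * η := by ring
    nlinarith [mul_pos hδ hη]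
  obtain ⟨x, hx⟩ := cauchySeq_tendsto_of_complete hcauchy
  exact ⟨x, fun n => (hclosed n).mem_of_tendsto hx
    (eventually_atTop.2 ⟨n, fun m hm => hanti hm (hpC m)⟩)⟩

/-- A bounded sequence in a uniformly convex Banach space has a point lying in the closed convex
hull of each of its tails. -/
theorem exists_mem_closure_convexHull_tails {x : ℕ → E} {R : ℝ} (hx : ∀ m, ‖x m‖ ≤ R) :
    ∃ p, ∀ n, p ∈ closure (convexHull ℝ (x '' Set.Ici n)) := by
  refine exists_forall_mem_of_antitone (fun m n hmn => ?_)
    (fun n => (convex_convexHull ℝ _).closure) (fun n => isClosed_closure) (R := R) fun n => ?_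
  · exact closure_mono (convexHull_mono (Set.image_mono (Set.Ici_subset_Ici.2 hmn)))
  · exact ⟨x n, subset_closure (subset_convexHull ℝ _ ⟨n, Set.self_mem_Ici, rfl⟩), hx n⟩

/-- Bounded sequences in a separable uniformly convex Banach space have weakly convergent
subsequences. -/
theorem exists_subseq_weakTendsto [TopologicalSpace.SeparableSpace E] {x : ℕ → E} {R : ℝ}
    (hx : ∀ m, ‖x m‖ ≤ R) : ∃ p, ∃ φ : ℕ → ℕ, StrictMono φ ∧ WeakTendsto (x ∘ φ) p := by
  obtain ⟨ℓ, hℓ1, hℓ⟩ := exists_separating_functionals (E := E)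
  have hR : 0 ≤ R := (norm_nonneg _).trans (hx 0)
  have hcpt : IsCompact (Set.univ.pi fun _ : ℕ => Set.Icc (-R) R) :=
    isCompact_univ_pi fun _ => isCompact_Icc
  obtain ⟨c, -, φ, hφ, hc⟩ := hcpt.tendsto_subseq (x := fun m i => ℓ i (x m)) fun m i _ => by
    refine abs_le.1 (((ℓ i).le_opNorm _).trans ?_)
    calc ‖ℓ i‖ * ‖x m‖ ≤ 1 * R := by gcongr; exacts [hℓ1 i, hx m]
      _ = R := one_mul R
  have hc' : ∀ i, Tendsto (fun m => ℓ i (x (φ m))) atTop (𝓝 (c i)) := fun i =>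
    (tendsto_pi_nhds.1 hc) i
  obtain ⟨p, hp⟩ := exists_mem_closure_convexHull_tails (x := x ∘ φ) fun m => hx (φ m)
  have hp' : ∀ i, ℓ i p = c i := fun i => eq_of_mem_closure_convexHull_tails hp (ℓ i) (hc' i)
  -- A subsequence violating the bound has its own point `p'` in all tail hulls. The separating
  -- functionals force `p' = p`, while `b ≤ f p'`.
  have key : ∀ f : StrongDual ℝ E, ∀ b, f p < b → ∀ᶠ m in atTop, f (x (φ m)) < b := by
    intro f b hb
    by_contra hcon
    rw [not_eventually] at hcon
    obtain ⟨ψ, hψ, hψ'⟩ := extraction_of_frequently_atTop hcon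
    obtain ⟨p', hp2⟩ := exists_mem_closure_convexHull_tails (x := x ∘ φ ∘ ψ) fun m => hx _
    have heq : p' = p := by
      rw [← sub_eq_zero]
      refine hℓ _ fun i => ?_
      rw [map_sub, hp', eq_of_mem_closure_convexHull_tails hp2 (ℓ i)
        ((hc' i).comp hψ.tendsto_atTop), sub_self]
    have := le_of_mem_closure_convexHull_tails hp2 f (c := b)
      (Eventually.of_forall fun m => not_lt.1 (hψ' m))
    rw [heq] at this
    exact this.not_gt hb
  refine ⟨p, φ, hφ, fun f => tendsto_order.2 ⟨fun b hb => ?_, fun b hb => key f b hb⟩⟩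
  filter_upwards [key (-f) (-b) (by simpa using hb)] with m hm
  simpa using hm

end UniformlyConvex

/-- A common subsequence for finitely many subsequence properties. -/
theorem exists_common_subseq {ι : Type*} [Finite ι] {P : ι → (ℕ → ℕ) → Prop}
    (hP : ∀ i (φ : ℕ → ℕ), StrictMono φ → ∃ ψ : ℕ → ℕ, StrictMono ψ ∧ P i (φ ∘ ψ))
    (hsub : ∀ i (φ ψ : ℕ → ℕ), P i φ → StrictMono ψ → P i (φ ∘ ψ)) :
    ∃ φ : ℕ → ℕ, StrictMono φ ∧ ∀ i, P i φ := by
  classical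
  cases nonempty_fintype ι
  suffices ∀ s : Finset ι, ∃ φ : ℕ → ℕ, StrictMono φ ∧ ∀ i ∈ s, P i φ by
    obtain ⟨φ, hφ, h⟩ := this Finset.univ
    exact ⟨φ, hφ, fun i => h i (Finset.mem_univ i)⟩
  intro s
  induction s using Finset.induction_on with
  | empty => exact ⟨id, strictMono_id, by simp⟩
  | insert i s _ ih =>
    obtain ⟨φ, hφ, h⟩ := ih
    obtain ⟨ψ, hψ, h'⟩ := hP i φ hφ
    refine ⟨φ ∘ ψ, hφ.comp hψ, fun j hj => ?_⟩
    rcases Finset.mem_insert.1 hj with rfl | hj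
    · exact h'
    · exact hsub j φ ψ (h j hj) hψ

/-! ### Uniform convexity of L^q. -/

section LpUniformlyConvex

/-- Strict convexity of the power on `[0, ∞)` applies when `|a| ≠ |b|`; otherwise `b = -a` and the
midpoint vanishes. -/
theorem abs_midpoint_rpow_lt {p : ℝ} (hp : 1 < p) {a b : ℝ} (hab : a ≠ b) :
    |(a + b) / 2| ^ p < (|a| ^ p + |b| ^ p) / 2 := by
  by_cases h : |a| = |b|
  · obtain rfl : b = -a := by
      rcases abs_eq_abs.1 h with h | h
      · exact absurd h hab
      · linarith
    have ha : a ≠ 0 := by rintro rfl; simp at hab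
    rw [add_neg_cancel, zero_div, abs_zero, Real.zero_rpow (by positivity)]
    positivity
  · have h1 := (strictConvexOn_rpow hp).2 (abs_nonneg a) (abs_nonneg b) h
      (show (0 : ℝ) < 1 / 2 by norm_num) (show (0 : ℝ) < 1 / 2 by norm_num) (by norm_num)
    simp only [smul_eq_mul] at h1
    have h2 : |(a + b) / 2| ≤ 1 / 2 * |a| + 1 / 2 * |b| := by
      rw [abs_div, abs_two]
      linarith [abs_add_le a b]
    linarith [Real.rpow_le_rpow (abs_nonneg _) h2 (by positivity : 0 ≤ p)]

theorem abs_midpoint_rpow_le {p : ℝ} (hp : 1 < p) (a b : ℝ) :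
    |(a + b) / 2| ^ p ≤ (|a| ^ p + |b| ^ p) / 2 := by
  by_cases hab : a = b
  · subst hab
    simp
  · exact (abs_midpoint_rpow_lt hp hab).le

/-- A quantitative form of the strict convexity of `|·| ^ p`. -/
theorem exists_abs_sub_rpow_le {p : ℝ} (hp : 1 < p) {ε : ℝ} (hε : 0 < ε) :
    ∃ K, 0 < K ∧ ∀ a b : ℝ, |a - b| ^ p ≤
      ε * (|a| ^ p + |b| ^ p) + K * ((|a| ^ p + |b| ^ p) / 2 - |(a + b) / 2| ^ p) := by
  have hp0 : 0 < p := by positivity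
  let G : ℝ × ℝ → ℝ := fun z => |z.1| ^ p + |z.2| ^ p
  let Δ : ℝ × ℝ → ℝ := fun z => |z.1 - z.2| ^ p
  let H : ℝ × ℝ → ℝ := fun z => G z / 2 - |(z.1 + z.2) / 2| ^ p
  have hrpow : Continuous fun t : ℝ => |t| ^ p :=
    continuous_abs.rpow_const fun _ => Or.inr hp0.le
  have hG : Continuous G := (hrpow.comp continuous_fst).add (hrpow.comp continuous_snd)
  have hΔ : Continuous Δ := hrpow.comp (continuous_fst.sub continuous_snd)
  have hH : Continuous H :=
    (hG.div_const 2).sub (hrpow.comp ((continuous_fst.add continuous_snd).div_const 2))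
  have hH0 : ∀ z, 0 ≤ H z := fun z => sub_nonneg.2 (abs_midpoint_rpow_le hp z.1 z.2)
  -- All terms are homogeneous of degree `p`, so the compact unit sphere suffices.
  suffices ∃ K, 0 < K ∧ ∀ z : ℝ × ℝ, ‖z‖ = 1 → Δ z ≤ ε * G z + K * H z by
    obtain ⟨K, hK, h⟩ := this
    refine ⟨K, hK, fun a b => ?_⟩
    by_cases hab : ((a, b) : ℝ × ℝ) = 0
    · obtain ⟨rfl, rfl⟩ := Prod.mk_eq_zero.1 hab
      simp [Real.zero_rpow hp0.ne']
    set r := ‖((a, b) : ℝ × ℝ)‖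
    have hr : 0 < r := norm_pos_iff.2 hab
    have hscale : ∀ t : ℝ, |r⁻¹ * t| ^ p = (r ^ p)⁻¹ * |t| ^ p := fun t => by
      rw [abs_mul, Real.mul_rpow (abs_nonneg _) (abs_nonneg _), abs_of_pos (inv_pos.2 hr),
        Real.inv_rpow hr.le]
    have h1 := h (r⁻¹ • (a, b)) (by
      rw [norm_smul, norm_inv, Real.norm_of_nonneg hr.le, inv_mul_cancel₀ hr.ne'])
    simp only [Δ, G, H, Prod.smul_mk, smul_eq_mul, ← mul_sub, ← mul_add, mul_div_assoc,
      hscale] at h1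
    have hrp : 0 < r ^ p := by positivity
    have h2 : (r ^ p)⁻¹ * |a - b| ^ p ≤ (r ^ p)⁻¹ * (ε * (|a| ^ p + |b| ^ p) +
        K * ((|a| ^ p + |b| ^ p) / 2 - |(a + b) / 2| ^ p)) := by
      refine h1.trans_eq ?_
      ring
    exact le_of_mul_le_mul_left h2 (inv_pos.2 hrp)
  -- Off `T` the term `ε * G` is enough. On the compact set `T`, `H` has a positive minimum: it
  -- vanishes only on the diagonal, where `Δ = 0 < ε * G` on the sphere.
  let T : Set (ℝ × ℝ) := Metric.sphere 0 1 ∩ {z | ε * G z ≤ Δ z}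
  have hT : IsCompact T :=
    (isCompact_sphere 0 1).inter_right (isClosed_le (hG.const_mul ε) hΔ)
  have hbound : ∀ z : ℝ × ℝ, ‖z‖ = 1 → z ∉ T → ∀ K, 0 ≤ K → Δ z ≤ ε * G z + K * H z := by
    intro z hz hzT K hK
    have : Δ z < ε * G z := by
      by_contra! h
      exact hzT ⟨mem_sphere_zero_iff_norm.2 hz, h⟩
    linarith [mul_nonneg hK (hH0 z)]
  rcases T.eq_empty_or_nonempty with hem | hne
  · exact ⟨1, one_pos, fun z hz => hbound z hz (by simp [hem]) 1 zero_le_one⟩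
  obtain ⟨z₀, hz₀, hmin⟩ := hT.exists_isMinOn hne hH.continuousOn
  obtain ⟨z₁, hz₁, hmax⟩ := hT.exists_isMaxOn hne hΔ.continuousOn
  have hGpos : ∀ z : ℝ × ℝ, 0 ≤ G z := fun z => by positivity
  have hm : 0 < H z₀ := by
    refine sub_pos.2 (abs_midpoint_rpow_lt hp fun h => ?_)
    have h0 : ε * G z₀ ≤ Δ z₀ := hz₀.2
    simp only [Δ, h, sub_self, abs_zero, Real.zero_rpow hp0.ne'] at h0
    have hG0 : G z₀ = 0 := le_antisymm (nonpos_of_mul_nonpos_right h0 hε) (hGpos _)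
    have h2 : |z₀.2| ^ p = 0 := by
      have h1 : 0 ≤ |z₀.1| ^ p := by positivity
      have h3 : 0 ≤ |z₀.2| ^ p := by positivity
      simp only [G] at hG0
      linarith
    have h3 : z₀.2 = 0 := abs_eq_zero.1 ((Real.rpow_eq_zero (abs_nonneg _) hp0.ne').1 h2)
    have h4 : z₀ = 0 := Prod.ext (h.trans h3) h3
    have h5 : ‖z₀‖ = 1 := mem_sphere_zero_iff_norm.1 hz₀.1
    rw [h4, norm_zero] at h5
    exact zero_ne_one h5
  have hΔ0 : ∀ z, 0 ≤ Δ z := fun z => by positivity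
  refine ⟨(Δ z₁ + 1) / H z₀, div_pos (by linarith [hΔ0 z₁]) hm, fun z hz => ?_⟩
  have hK : 0 ≤ (Δ z₁ + 1) / H z₀ := div_nonneg (by linarith [hΔ0 z₁]) hm.le
  by_cases hzT : z ∈ T
  · have h1 : Δ z ≤ Δ z₁ := hmax hzT
    have h2 : H z₀ ≤ H z := hmin hzT
    have h3 : Δ z₁ + 1 ≤ (Δ z₁ + 1) / H z₀ * H z := by
      calc Δ z₁ + 1 = (Δ z₁ + 1) / H z₀ * H z₀ := (div_mul_cancel₀ _ hm.ne').symm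
        _ ≤ _ := by gcongr
    linarith [mul_nonneg hε.le (hGpos z)]
  · exact hbound z hz hzT _ hK

variable {α : Type*} [MeasurableSpace α] {μ : Measure α} {q : ℝ≥0∞}

theorem norm_Lp_rpow_eq_integral (hq0 : q ≠ 0) (hq : q ≠ ∞) (f : Lp ℝ q μ) :
    ‖f‖ ^ q.toReal = ∫ x, |f x| ^ q.toReal ∂μ := by
  have hpos : 0 < q.toReal := ENNReal.toReal_pos hq0 hq
  have hint : 0 ≤ ∫ x, ‖f x‖ ^ q.toReal ∂μ := integral_nonneg fun x => by positivity
  rw [Lp.norm_def, (Lp.memLp f).eLpNorm_eq_integral_rpow_norm hq0 hq,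
    ENNReal.toReal_ofReal (by positivity), Real.rpow_inv_rpow hint hpos.ne']
  rfl

/-- `L^q` is uniformly convex for `1 < q < ∞`. -/
theorem uniformConvexSpace_Lp [Fact (1 ≤ q)] (hq1 : 1 < q) (hq : q ≠ ∞) :
    UniformConvexSpace (Lp ℝ q μ) where
  uniform_convex ε hε := by
    have hq0 : q ≠ 0 := (zero_lt_one.trans hq1).ne'
    set p := q.toReal
    have hp : 1 < p := by
      rw [← ENNReal.toReal_one]
      exact (ENNReal.toReal_lt_toReal ENNReal.one_ne_top hq).2 hq1
    have hp0 : 0 < p := zero_lt_one.trans hp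
    have hεp : 0 < ε ^ p := by positivity
    -- For unit vectors the first term contributes `ε ^ p / 4 * 2`, so half of `ε ^ p` remains to
    -- bound the midpoint deficit from below.
    obtain ⟨K, hK, hineq⟩ := exists_abs_sub_rpow_le hp (show 0 < ε ^ p / 4 by positivity)
    -- The minimum with 1 keeps the base `1 - κ` of the real power nonnegative.
    set κ := min (ε ^ p / (2 * K)) 1
    have hκ : 0 < κ := by positivity
    have hκ1 : 0 ≤ 1 - κ := sub_nonneg.2 (min_le_right _ _)
    have hlt : (1 - κ) ^ p⁻¹ < 1 := Real.rpow_lt_one hκ1 (by linarith) (by positivity)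
    refine ⟨2 * (1 - (1 - κ) ^ p⁻¹), by linarith, fun f hf g hg hfg => ?_⟩
    have hint : ∀ h : Lp ℝ q μ, Integrable (fun x => |h x| ^ p) μ := fun h =>
      (Lp.memLp h).integrable_norm_rpow hq0 hq
    have hmid : ‖(1 / 2 : ℝ) • (f + g)‖ ^ p = ∫ x, |(f x + g x) / 2| ^ p ∂μ := by
      rw [norm_Lp_rpow_eq_integral hq0 hq]
      refine integral_congr_ae ?_
      filter_upwards [Lp.coeFn_smul (1 / 2 : ℝ) (f + g), Lp.coeFn_add f g] with x h1 h2
      rw [h1, Pi.smul_apply, h2, Pi.add_apply, smul_eq_mul, one_div_mul_eq_div]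
    have hmidint : Integrable (fun x => |(f x + g x) / 2| ^ p) μ := by
      refine (hint ((1 / 2 : ℝ) • (f + g))).congr ?_
      filter_upwards [Lp.coeFn_smul (1 / 2 : ℝ) (f + g), Lp.coeFn_add f g] with x h1 h2
      rw [h1, Pi.smul_apply, h2, Pi.add_apply, smul_eq_mul, one_div_mul_eq_div]
    have hsum : Integrable (fun x => |f x| ^ p + |g x| ^ p) μ := (hint f).add (hint g)
    have hsub : ‖f - g‖ ^ p ≤ ε ^ p / 4 * (‖f‖ ^ p + ‖g‖ ^ p) +
        K * ((‖f‖ ^ p + ‖g‖ ^ p) / 2 - ‖(1 / 2 : ℝ) • (f + g)‖ ^ p) := by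
      have h1 : Integrable (fun x => (|f x| ^ p + |g x| ^ p) / 2 - |(f x + g x) / 2| ^ p) μ :=
        (hsum.div_const 2).sub hmidint
      calc ‖f - g‖ ^ p = ∫ x, |(f - g : Lp ℝ q μ) x| ^ p ∂μ :=
            norm_Lp_rpow_eq_integral hq0 hq _
        _ ≤ ∫ x, (ε ^ p / 4 * (|f x| ^ p + |g x| ^ p) +
              K * ((|f x| ^ p + |g x| ^ p) / 2 - |(f x + g x) / 2| ^ p)) ∂μ := by
            refine integral_mono_ae (hint _) ((hsum.const_mul _).add (h1.const_mul _)) ?_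
            filter_upwards [Lp.coeFn_sub f g] with x hx
            rw [hx]
            exact hineq (f x) (g x)
        _ = _ := by
            rw [integral_add (hsum.const_mul _) (h1.const_mul _), integral_const_mul,
              integral_const_mul, integral_sub (hsum.div_const 2) hmidint, integral_div,
              integral_add (hint f) (hint g), hmid, norm_Lp_rpow_eq_integral hq0 hq f,
              norm_Lp_rpow_eq_integral hq0 hq g]
    rw [hf, hg, Real.one_rpow] at hsub
    have h1 : ε ^ p ≤ ‖f - g‖ ^ p := by gcongr
    have h2 : ε ^ p / (2 * K) ≤ 1 - ‖(1 / 2 : ℝ) • (f + g)‖ ^ p := by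
      rw [div_le_iff₀ (by positivity)]
      linarith
    have h3 : ‖(1 / 2 : ℝ) • (f + g)‖ ^ p ≤ 1 - κ := by
      linarith [min_le_left (ε ^ p / (2 * K)) 1]
    have h4 := Real.rpow_le_rpow (by positivity) h3 (inv_pos.2 hp0).le
    rw [Real.rpow_rpow_inv (norm_nonneg _) hp0.ne', norm_smul] at h4
    norm_num at h4
    linarith

end LpUniformlyConvex

variable {d : ℕ}

/-! ### Weak* convergence of functionals. -/

section WeakStar

/-- Bounded functionals converging pointwise on a dense range converge pointwise. -/
theorem tendsto_of_denseRange {X ι : Type*} [NormedAddCommGroup X] [NormedSpace ℝ X]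
    {f : ℕ → StrongDual ℝ X} {f₀ : StrongDual ℝ X} {R : ℝ} (hR : ∀ m, ‖f m‖ ≤ R) {e : ι → X}
    (he : DenseRange e) (h : ∀ i, Tendsto (fun m => f m (e i)) atTop (𝓝 (f₀ (e i)))) (x : X) :
    Tendsto (fun m => f m x) atTop (𝓝 (f₀ x)) := by
  have hR0 : 0 ≤ R := (norm_nonneg _).trans (hR 0)
  rw [Metric.tendsto_atTop]
  intro ε hε
  set B := R + ‖f₀‖ + 1
  have hB : 0 < B := by positivity
  obtain ⟨i, hi⟩ := Metric.denseRange_iff.1 he x (ε / (2 * B)) (by positivity)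
  obtain ⟨N, hN⟩ := Metric.tendsto_atTop.1 (h i) (ε / 2) (by positivity)
  refine ⟨N, fun m hm => ?_⟩
  have h1 := hN m hm
  rw [dist_eq_norm] at h1 hi ⊢
  have h2 : f m x - f₀ x = (f m (e i) - f₀ (e i)) + (f m (x - e i) - f₀ (x - e i)) := by
    simp only [map_sub]; ring
  have h3 : ‖f m (x - e i) - f₀ (x - e i)‖ ≤ B * ‖x - e i‖ := by
    calc ‖f m (x - e i) - f₀ (x - e i)‖ ≤ ‖f m‖ * ‖x - e i‖ + ‖f₀‖ * ‖x - e i‖ :=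
          (norm_sub_le _ _).trans (add_le_add ((f m).le_opNorm _) (f₀.le_opNorm _))
      _ ≤ R * ‖x - e i‖ + ‖f₀‖ * ‖x - e i‖ := by gcongr; exact hR m
      _ ≤ B * ‖x - e i‖ := by
          have : B * ‖x - e i‖ = R * ‖x - e i‖ + ‖f₀‖ * ‖x - e i‖ + ‖x - e i‖ := by
            simp only [B]; ring
          linarith [norm_nonneg (x - e i)]
  have h4 : B * ‖x - e i‖ < ε / 2 := by
    calc B * ‖x - e i‖ < B * (ε / (2 * B)) := by gcongr
      _ = ε / 2 := by field_simp
  rw [h2]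
  linarith [norm_add_le (f m (e i) - f₀ (e i)) (f m (x - e i) - f₀ (x - e i))]

/-- The duality pairing is jointly continuous along bounded weak* convergent functionals and norm
convergent vectors. -/
theorem tendsto_apply_of_tendsto {X : Type*} [NormedAddCommGroup X] [NormedSpace ℝ X]
    {f : ℕ → StrongDual ℝ X} {f₀ : StrongDual ℝ X} {R : ℝ} (hR : ∀ m, ‖f m‖ ≤ R)
    (hf : ∀ x, Tendsto (fun m => f m x) atTop (𝓝 (f₀ x))) {x : ℕ → X} {x₀ : X}
    (hx : Tendsto x atTop (𝓝 x₀)) : Tendsto (fun m => f m (x m)) atTop (𝓝 (f₀ x₀)) := by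
  have h1 : Tendsto (fun m => f m (x m - x₀)) atTop (𝓝 0) := by
    refine squeeze_zero_norm (a := fun m => R * ‖x m - x₀‖) (fun m => ?_) ?_
    · exact ((f m).le_opNorm _).trans (by gcongr; exact hR m)
    · simpa using (tendsto_iff_norm_sub_tendsto_zero.1 hx).const_mul R
  simpa using h1.add (hf x₀)

/-- Sequential Banach–Alaoglu theorem. -/
theorem exists_subseq_weakStar {X : Type*} [NormedAddCommGroup X] [NormedSpace ℝ X]
    [TopologicalSpace.SeparableSpace X] {f : ℕ → StrongDual ℝ X} {R : ℝ} (hR : ∀ m, ‖f m‖ ≤ R) :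
    ∃ f₀ : StrongDual ℝ X, ∃ φ : ℕ → ℕ, StrictMono φ ∧
      ∀ x, Tendsto (fun m => f (φ m) x) atTop (𝓝 (f₀ x)) := by
  obtain ⟨f₀, -, φ, hφ, h⟩ := WeakDual.isSeqCompact_closedBall ℝ X 0 R
    (x := fun m => StrongDual.toWeakDual (f m)) fun m => by
      simpa using hR m
  exact ⟨WeakDual.toStrongDual f₀, φ, hφ, fun x => ((WeakDual.eval_continuous x).tendsto f₀).comp h⟩

/-- The bound is only assumed frequently because it comes from a sublevel of a liminf; convergence
of `f m x` along all `m` makes that sufficient. -/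
theorem norm_le_of_frequently_norm_le {X : Type*} [NormedAddCommGroup X] [NormedSpace ℝ X]
    {f : ℕ → StrongDual ℝ X} {f₀ : StrongDual ℝ X}
    (hf : ∀ x, Tendsto (fun m => f m x) atTop (𝓝 (f₀ x))) {c : ℝ}
    (hc : ∃ᶠ m in atTop, ‖f m‖ ≤ c) : ‖f₀‖ ≤ c := by
  obtain ⟨m, hm⟩ := hc.exists
  refine f₀.opNorm_le_bound ((norm_nonneg _).trans hm) fun x => ?_
  refine le_of_tendsto_of_frequently (hf x).norm (hc.mono fun m hm => ?_)
  exact ((f m).le_opNorm x).trans (by gcongr)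

end WeakStar

/-! ### Separability of `C0`. -/

section Separable

/-- At a point outside the domain, the complement of a compact subset of the domain is a
neighbourhood on which the extension is small. -/
theorem continuous_zeroExt_C0 (Ω : BddOpen d) (φ : C0 Ω) : Continuous (zeroExt Ω φ) := by
  rw [continuous_iff_continuousAt]
  intro x
  by_cases hx : x ∈ Ω.carrier
  · refine (Ω.isOpen.isOpenEmbedding_subtypeVal.continuousAt_iff (g := zeroExt Ω φ)
      (x := ⟨x, hx⟩)).1 ?_
    have : zeroExt Ω φ ∘ Subtype.val = φ := by
      funext y
      exact zeroExt_apply_mem Ω φ y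
    rw [this]
    exact (map_continuous φ).continuousAt
  · rw [ContinuousAt, zeroExt_apply_notMem Ω _ hx, Metric.tendsto_nhds]
    intro ε hε
    have h0 := (Metric.tendsto_nhds.1 (zero_at_infty φ)) ε hε
    obtain ⟨K, hK, hKφ⟩ := mem_cocompact.1 h0
    have hK' : IsClosed (Subtype.val '' K : Set (Eucl d)) :=
      (hK.image continuous_subtype_val).isClosed
    have hxK : x ∈ (Subtype.val '' K : Set (Eucl d))ᶜ := by
      rintro ⟨a, -, rfl⟩
      exact hx a.2
    filter_upwards [hK'.isOpen_compl.mem_nhds hxK] with z hz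
    by_cases hzΩ : z ∈ Ω.carrier
    · have h1 : (⟨z, hzΩ⟩ : Ω) ∈ Kᶜ := fun h => hz ⟨_, h, rfl⟩
      have h2 := zeroExt_apply_mem Ω φ ⟨z, hzΩ⟩
      simp only at h2
      rw [h2]
      exact hKφ h1
    · simpa [zeroExt_apply_notMem Ω _ hzΩ] using hε

/-- Restriction of the extension by zero to the closure of the domain. -/
noncomputable def toContinuousMapClosure (Ω : BddOpen d) (φ : C0 Ω) : C(closure Ω.carrier, ℝ) :=
  ⟨fun x => zeroExt Ω φ x, (continuous_zeroExt_C0 Ω φ).comp continuous_subtype_val⟩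

theorem isometry_toContinuousMapClosure (Ω : BddOpen d) [CompactSpace (closure Ω.carrier)] :
    Isometry (toContinuousMapClosure Ω) := by
  refine Isometry.of_dist_eq fun φ ψ => ?_
  have hsub : ∀ x, zeroExt Ω φ x - zeroExt Ω ψ x = zeroExt Ω ⇑(φ - ψ) x := fun x => by
    have h : (⇑(φ - ψ) : Ω → ℝ) = ⇑φ + (-1 : ℝ) • ⇑ψ := by
      rw [sub_eq_add_neg, ← neg_one_smul ℝ ψ, C0.coe_add, C0.coe_smul]
    rw [h, zeroExt_add, zeroExt_smul]
    ring
  refine le_antisymm ?_ ?_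
  · refine (ContinuousMap.dist_le dist_nonneg).2 fun x => ?_
    rw [dist_eq_norm, dist_eq_norm]
    change ‖zeroExt Ω φ x - zeroExt Ω ψ x‖ ≤ _
    rw [hsub]
    exact norm_zeroExt_le Ω (norm_nonneg _) (φ - ψ).norm_coe_le_norm _
  · rw [dist_eq_norm, C0.norm_le dist_nonneg]
    intro x
    have h1 := ContinuousMap.dist_apply_le_dist (f := toContinuousMapClosure Ω φ)
      (g := toContinuousMapClosure Ω ψ) ⟨x, subset_closure x.2⟩
    refine le_trans (le_of_eq ?_) h1
    rw [dist_eq_norm]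
    change _ = ‖zeroExt Ω φ x - zeroExt Ω ψ x‖
    rw [hsub, zeroExt_apply_mem]

/-- Extension by zero embeds `C0 Ω` isometrically into the continuous functions on a compact metric
space, which are second countable. Sequential Banach-Alaoglu for Radon measures rests on this. -/
instance (Ω : BddOpen d) : TopologicalSpace.SeparableSpace (C0 Ω) := by
  have : CompactSpace (closure Ω.carrier) :=
    isCompact_iff_compactSpace.1 Ω.isBounded.isCompact_closure
  have := (isometry_toContinuousMapClosure Ω).isEmbedding.secondCountableTopology
  infer_instance

end Separable

/-! ### Integral functionals and inclusions between Lebesgue spaces. -/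

section Pairing

variable {q : ℝ≥0∞} [Fact (1 ≤ q)]

/-- Integration against a bounded measurable function is a continuous functional on `L^q`. -/
theorem exists_integral_functional (q : ℝ≥0∞) [Fact (1 ≤ q)] (Ω : BddOpen d) {f : Eucl d → ℝ}
    (hf : Measurable f) {C : ℝ} (hC : ∀ x, ‖f x‖ ≤ C) :
    ∃ T : StrongDual ℝ (LpOn q Ω), ∀ w, T w = ∫ x, w x * f x ∂Ω.vol := by
  have : Fact (1 ≤ q.conjExponent) := ⟨by simp [ENNReal.conjExponent]⟩
  have hmem : MemLp f q.conjExponent Ω.vol :=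
    MemLp.of_bound hf.aestronglyMeasurable C (Eventually.of_forall hC)
  refine ⟨((ContinuousLinearMap.mul ℝ ℝ).lpPairing Ω.vol q q.conjExponent).flip (hmem.toLp f),
    fun w => ?_⟩
  rw [ContinuousLinearMap.flip_apply, ContinuousLinearMap.lpPairing_eq_integral]
  refine integral_congr_ae ?_
  filter_upwards [hmem.coeFn_toLp] with x hx
  rw [hx]
  rfl

theorem WeakTendsto.tendsto_integral_mul {Ω : BddOpen d} {w : ℕ → LpOn q Ω} {w₀ : LpOn q Ω}
    (h : WeakTendsto w w₀) {f : Eucl d → ℝ} (hf : Measurable f) {C : ℝ} (hC : ∀ x, ‖f x‖ ≤ C) :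
    Tendsto (fun m => ∫ x, w m x * f x ∂Ω.vol) atTop (𝓝 (∫ x, w₀ x * f x ∂Ω.vol)) := by
  obtain ⟨T, hT⟩ := exists_integral_functional q Ω hf hC
  simpa only [hT] using h T

theorem WeakTendsto.tendsto_toMeasure {Ω : BddOpen d} {w : ℕ → LpOn q Ω} {w₀ : LpOn q Ω}
    (h : WeakTendsto w w₀) (φ : C0 Ω) :
    Tendsto (fun m => toMeasure (w m) φ) atTop (𝓝 (toMeasure w₀ φ)) :=
  h.tendsto_integral_mul (measurable_zeroExt Ω (map_continuous φ))
    (norm_zeroExt_le Ω (norm_nonneg φ) φ.norm_coe_le_norm)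

/-- The continuous inclusion `L^p(Ω) ⊆ L^q(Ω)` for `q ≤ p`. -/
theorem exists_inclusion {p : ℝ≥0∞} [Fact (1 ≤ p)] (hqp : q ≤ p) (Ω : BddOpen d) :
    ∃ ι : LpOn p Ω →L[ℝ] LpOn q Ω, ∀ w, ι w =ᵐ[Ω.vol] w := by
  have hmem : ∀ w : LpOn p Ω, MemLp w q Ω.vol := fun w => (Lp.memLp w).mono_exponent hqp
  let T : LpOn p Ω →ₗ[ℝ] LpOn q Ω :=
    { toFun := fun w => (hmem w).toLp w
      map_add' := fun v w => by
        rw [← MemLp.toLp_add]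
        exact MemLp.toLp_congr _ _ (Lp.coeFn_add v w)
      map_smul' := fun c w => by
        rw [RingHom.id_apply, ← MemLp.toLp_const_smul]
        exact MemLp.toLp_congr _ _ (Lp.coeFn_smul c w) }
  set κ : ℝ≥0∞ := Ω.vol Set.univ ^ (1 / q.toReal - 1 / p.toReal)
  -- On a null domain all functions agree almost everywhere, so the zero map serves; otherwise the
  -- power of the volume in `κ` is finite whatever the sign of its exponent.
  by_cases hΩ : Ω.vol = 0
  · exact ⟨0, fun w => eventually_bot.filter_mono (ae_eq_bot.2 hΩ).le⟩
  have hκ : κ ≠ ∞ := by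
    refine ENNReal.rpow_ne_top_of_ne_zero ?_ (measure_ne_top _ _)
    simpa using hΩ
  refine ⟨T.mkContinuous κ.toReal fun w => ?_, fun w => (hmem w).coeFn_toLp⟩
  change ‖(hmem w).toLp w‖ ≤ _
  rw [Lp.norm_toLp, Lp.norm_def, ← ENNReal.toReal_mul, mul_comm]
  exact ENNReal.toReal_mono (ENNReal.mul_ne_top (Lp.eLpNorm_ne_top w) hκ)
    (eLpNorm_le_eLpNorm_mul_rpow_measure_univ hqp (Lp.aestronglyMeasurable w))

end Pairing

/-! ### Weak continuity of the convolution. -/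

section Convolution

theorem exists_integral_norm_le (S : BddOpen d) :
    ∃ C, 0 ≤ C ∧ ∀ g : LpOn 2 S, ∫ x, ‖g x‖ ∂S.vol ≤ C * ‖g‖ := by
  have : Fact ((1 : ℝ≥0∞) ≤ 1) := ⟨le_rfl⟩
  obtain ⟨ι, hι⟩ := exists_inclusion (q := 1) (p := 2) (by norm_num) S
  refine ⟨‖ι‖, norm_nonneg _, fun g => ?_⟩
  have h : ∫ x, ‖g x‖ ∂S.vol = ‖ι g‖ := by
    rw [L1.norm_eq_integral_norm]
    refine integral_congr_ae ?_
    filter_upwards [hι g] with x hx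
    rw [hx]
  rw [h]
  exact ι.le_opNorm g

/-- The modulus of continuity of a correlation depends on `g` only through its L¹ norm, so bounded
kernels give equicontinuous correlations. -/
theorem norm_corr_sub_le (Ω S : BddOpen d) (g : LpOn 2 S) (φ : C_c(Ω, ℝ)) {y y' : Ω.sub S}
    {η : ℝ} (h : ∀ x, ‖zeroExt Ω φ (x + y) - zeroExt Ω φ (x + y')‖ ≤ η) :
    ‖corr Ω S g φ y - corr Ω S g φ y'‖ ≤ η * ∫ x, ‖g x‖ ∂S.vol := by
  rw [corr_apply, corr_apply, ← integral_sub (integrable_corr Ω S g φ y)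
    (integrable_corr Ω S g φ y'), ← integral_const_mul]
  refine norm_integral_le_of_norm_le ((integrable_of_Lp S g).norm.const_mul η)
    (Eventually.of_forall fun x => ?_)
  rw [← sub_mul, norm_mul]
  gcongr
  exact h x

/-- Weak convergence of the kernels implies uniform convergence of the correlations. -/
theorem WeakTendsto.tendsto_corr {Ω S : BddOpen d} {g : ℕ → LpOn 2 S} {g₀ : LpOn 2 S}
    (h : WeakTendsto g g₀) {R : ℝ} (hR : ∀ m, ‖g m‖ ≤ R) (φ : C_c(Ω, ℝ)) :
    Tendsto (fun m => corr Ω S (g m) φ) atTop (𝓝 (corr Ω S g₀ φ)) := by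
  obtain ⟨C, hC0, hC⟩ := exists_integral_norm_le S
  obtain ⟨Cφ, -, hCφ⟩ := exists_bound Ω φ
  have hcont := continuous_zeroExt Ω φ
  have huc : UniformContinuous (zeroExt Ω φ) :=
    hcont.uniformContinuous_of_tendsto_cocompact (hasCompactSupport_zeroExt Ω φ).is_zero_at_infty
  have hpt : ∀ y : Ω.sub S, Tendsto (fun m => corr Ω S (g m) φ y) atTop (𝓝 (corr Ω S g₀ φ y)) :=
    fun y => by
      simpa only [corr_apply, mul_comm] using h.tendsto_integral_mul
        (f := fun x => zeroExt Ω φ (x + y)) (hcont.comp (continuous_id.add continuous_const)).measurable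
        fun x => hCφ (x + y)
  have hR0 : 0 ≤ R := (norm_nonneg _).trans (hR 0)
  have hg₀ : ‖g₀‖ ≤ R := h.norm_le hR
  rw [Metric.tendsto_atTop]
  intro ε hε
  set η := ε / (4 * (C * R + 1))
  have hη : 0 < η := by positivity
  have hηC : η * (C * R) ≤ ε / 4 := by
    have : η * (C * R + 1) = ε / 4 := by simp only [η]; field_simp
    linarith
  obtain ⟨δ, hδ, hδφ⟩ := Metric.uniformContinuous_iff.1 huc η hη
  -- Pointwise convergence on a finite `δ`-net, combined with equicontinuity, becomes uniform: three
  -- errors of size `ε / 4`.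
  have htb : TotallyBounded (Ω.sub S).carrier :=
    (Ω.sub S).isBounded.isCompact_closure.totallyBounded.subset subset_closure
  obtain ⟨t, htsub, htfin, hcover⟩ := Metric.finite_approx_of_totallyBounded htb δ hδ
  have hev : ∀ᶠ m in atTop, ∀ y ∈ t, ∀ hy : y ∈ (Ω.sub S).carrier,
      ‖corr Ω S (g m) φ ⟨y, hy⟩ - corr Ω S g₀ φ ⟨y, hy⟩‖ < ε / 4 := by
    refine (eventually_all_finite htfin).2 fun y hy => ?_
    filter_upwards [Metric.tendsto_nhds.1 (hpt ⟨y, htsub hy⟩) (ε / 4) (by positivity)] with m hm _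
    rwa [← dist_eq_norm]
  obtain ⟨N, hN⟩ := eventually_atTop.1 hev
  refine ⟨N, fun m hm => ?_⟩
  rw [dist_eq_norm]
  refine lt_of_le_of_lt ((C0.norm_le (C := 3 * ε / 4) (by positivity)).2 fun y => ?_) (by linarith)
  obtain ⟨z, hz, hyz⟩ := Set.mem_iUnion₂.1 (hcover y.2)
  let z' : Ω.sub S := ⟨z, htsub hz⟩
  have hclose : ∀ g' : LpOn 2 S, ‖g'‖ ≤ R →
      ‖corr Ω S g' φ y - corr Ω S g' φ z'‖ ≤ ε / 4 := fun g' hg' => by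
    refine (norm_corr_sub_le Ω S g' φ (η := η) fun x => ?_).trans ?_
    · rw [← dist_eq_norm]
      refine (hδφ ?_).le
      rw [dist_add_left]
      exact hyz
    · refine le_trans ?_ hηC
      gcongr
      exact (hC g').trans (by gcongr)
  have h1 := hN m hm z hz z'.2
  have h2 := hclose (g m) (hR m)
  have h3 := hclose g₀ hg₀
  have h4 : (corr Ω S (g m) φ - corr Ω S g₀ φ) y = corr Ω S (g m) φ y - corr Ω S g₀ φ y := by
    rw [sub_eq_add_neg, ← neg_one_smul ℝ (corr Ω S g₀ φ), C0.coe_add, C0.coe_smul]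
    simp [sub_eq_add_neg]
  rw [h4]
  rw [Real.norm_eq_abs, abs_le] at h2 h3 ⊢
  rw [Real.norm_eq_abs, abs_lt] at h1
  constructor <;> linarith [h1.1, h1.2, h2.1, h2.2, h3.1, h3.2]

/-- The L² bound on correlations extends by density from test functions to all `v`; taking `v` to be
the convolution itself gives the estimate. -/
theorem norm_conv_two_le {Ω S : BddOpen d} (μ : RadonMeasure (Ω.sub S)) (g : LpOn 2 S) :
    ‖conv (q := 2) le_rfl μ g‖ ≤ ‖μ‖ * ‖g‖ := by
  set w : LpOn 2 Ω := conv le_rfl μ g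
  have h : ∀ v : LpOn 2 Ω, inner ℝ w v ≤ ‖μ‖ * ‖g‖ * ‖v‖ := fun v => by
    refine (denseRange_testToL2 Ω).induction_on (p := fun v => inner ℝ w v ≤ ‖μ‖ * ‖g‖ * ‖v‖) v
      (isClosed_le (by fun_prop) (by fun_prop)) fun φ => ?_
    rw [inner_testToL2, conv_spec]
    calc μ (corr Ω S g φ) ≤ ‖μ (corr Ω S g φ)‖ := le_abs_self _
      _ ≤ ‖μ‖ * ‖corr Ω S g φ‖ := μ.le_opNorm _
      _ ≤ ‖μ‖ * (‖(memLp_zeroExt Ω 2 φ).toLp‖ * ‖g‖) := by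
          gcongr
          exact (C0.norm_le (by positivity)).2 (norm_corr_le Ω S g φ)
      _ = _ := by change _ = (‖μ‖ * ‖g‖) * ‖(memLp_zeroExt Ω 2 φ).toLp‖; ring
  have h1 := h w
  rw [real_inner_self_eq_norm_mul_norm] at h1
  rcases (norm_nonneg w).eq_or_lt with h0 | h0
  · rw [← h0]
    positivity
  · exact le_of_mul_le_mul_right h1 h0

/-- Weak continuity of the convolution along bounded sequences. -/
theorem weakTendsto_conv {q : ℝ≥0∞} [Fact (1 ≤ q)] (hq : q ≤ 2) {Ω S : BddOpen d}
    {μ : ℕ → RadonMeasure (Ω.sub S)} {μ₀ : RadonMeasure (Ω.sub S)} {B : ℝ} (hB : ∀ m, ‖μ m‖ ≤ B)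
    (hμ : ∀ φ, Tendsto (fun m => μ m φ) atTop (𝓝 (μ₀ φ))) {g : ℕ → LpOn 2 S} {g₀ : LpOn 2 S}
    (hg : WeakTendsto g g₀) {R : ℝ} (hR : ∀ m, ‖g m‖ ≤ R) :
    WeakTendsto (fun m => conv hq (μ m) (g m)) (conv hq μ₀ g₀) := by
  obtain ⟨ι, hι⟩ := exists_inclusion hq Ω
  have hconv : ∀ (μ : RadonMeasure (Ω.sub S)) (g : LpOn 2 S),
      ι (conv le_rfl μ g) = conv hq μ g := fun μ g => by
    refine (existsUnique_conv hq μ g).unique (fun φ => ?_) (conv_spec hq μ g)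
    rw [← conv_spec le_rfl μ g φ]
    refine integral_congr_ae ?_
    filter_upwards [hι (conv le_rfl μ g)] with x hx
    rw [hx]
  -- In L² the dual is the space itself and test functions are dense, so testing suffices; the
  -- continuous inclusion `ι` carries the result to L^q.
  suffices WeakTendsto (fun m => conv (q := 2) le_rfl (μ m) (g m)) (conv le_rfl μ₀ g₀) by
    simpa only [hconv] using this.map ι
  intro f
  obtain ⟨v, rfl⟩ := (InnerProductSpace.toDual ℝ (LpOn 2 Ω)).surjective f
  simp only [InnerProductSpace.toDual_apply_apply]
  have key := tendsto_of_denseRange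
    (f := fun m => InnerProductSpace.toDual ℝ (LpOn 2 Ω) (conv (q := 2) le_rfl (μ m) (g m)))
    (f₀ := InnerProductSpace.toDual ℝ (LpOn 2 Ω) (conv (q := 2) le_rfl μ₀ g₀)) (R := B * R)
    (fun m => by
      rw [LinearIsometryEquiv.norm_map]
      have hB0 : 0 ≤ B := (norm_nonneg _).trans (hB m)
      exact (norm_conv_two_le _ _).trans
        (mul_le_mul (hB m) (hR m) (norm_nonneg _) hB0))
    (denseRange_testToL2 Ω) (fun φ => by
      simp only [InnerProductSpace.toDual_apply_apply, inner_testToL2, conv_spec]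
      exact tendsto_apply_of_tendsto hB hμ (hg.tendsto_corr hR φ)) v
  simpa only [InnerProductSpace.toDual_apply_apply, real_inner_comm] using key

theorem weakTendsto_layerConv {q : ℝ≥0∞} [Fact (1 ≤ q)] (hq : q ≤ 2) {Ω S : BddOpen d} {N N' : ℕ}
    {E : Finset (Fin N × Fin N')} {μ : ℕ → Fin N → RadonMeasure (Ω.sub S)}
    {μ₀ : Fin N → RadonMeasure (Ω.sub S)} {B : ℝ} (hB : ∀ m n, ‖μ m n‖ ≤ B)
    (hμ : ∀ n φ, Tendsto (fun m => μ m n φ) atTop (𝓝 (μ₀ n φ)))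
    {θ : ℕ → E → LpOn 2 S} {θ₀ : E → LpOn 2 S} (hθ : ∀ e, WeakTendsto (fun m => θ m e) (θ₀ e))
    {R : ℝ} (hR : ∀ m e, ‖θ m e‖ ≤ R) (k : Fin N') :
    WeakTendsto (fun m => layerConv hq (μ m) (θ m) k) (layerConv hq μ₀ θ₀ k) := by
  refine WeakTendsto.sum _ fun e _ => ?_
  by_cases he : e.1.2 = k
  · simp only [he, if_true]
    exact weakTendsto_conv hq (fun m => hB m _) (hμ _) (hθ e) fun m => hR m e
  · simp only [he, if_false]
    exact WeakTendsto.const 0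

end Convolution

/-! ### Lower limits in `ℝ≥0∞`. -/

section Liminf

/-- Reduces lower semicontinuity to closedness of sublevel sets: any `c` strictly above the liminf
is frequently an upper bound. -/
theorem le_liminf_of_forall_frequently_le {f : ℕ → ℝ≥0∞} {a : ℝ≥0∞}
    (h : ∀ c, (∃ᶠ m in atTop, f m ≤ c) → a ≤ c) : a ≤ liminf f atTop := by
  by_contra! hlt
  obtain ⟨c, hc, hca⟩ := exists_between hlt
  exact (h c ((frequently_lt_of_liminf_lt (by isBoundedDefault) hc).mono fun _ hm => hm.le)).not_gt
    hca

theorem add_le_liminf_add {f g : ℕ → ℝ≥0∞} {a b : ℝ≥0∞} (hf : a ≤ liminf f atTop)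
    (hg : b ≤ liminf g atTop) : a + b ≤ liminf (fun m => f m + g m) atTop := by
  refine (add_le_add hf hg).trans ?_
  have hmono : ∀ h : ℕ → ℝ≥0∞, Monotone fun n => ⨅ i ≥ n, h i := fun h m n hmn =>
    biInf_mono fun i hi => hmn.trans hi
  simp only [liminf_eq_iSup_iInf_of_nat]
  rw [ENNReal.iSup_add_iSup_of_monotone (hmono f) (hmono g)]
  exact iSup_mono fun n => le_iInf₂ fun i hi => add_le_add (iInf₂_le i hi) (iInf₂_le i hi)

theorem sum_le_liminf_sum {ι : Type*} (s : Finset ι) {f : ι → ℕ → ℝ≥0∞} {a : ι → ℝ≥0∞}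
    (h : ∀ i ∈ s, a i ≤ liminf (f i) atTop) :
    ∑ i ∈ s, a i ≤ liminf (fun m => ∑ i ∈ s, f i m) atTop := by
  classical
  induction s using Finset.induction_on with
  | empty => simp
  | insert i s hi ih =>
    simp only [Finset.sum_insert hi]
    exact add_le_liminf_add (h i (Finset.mem_insert_self i s))
      (ih fun j hj => h j (Finset.mem_insert_of_mem hj))

theorem mul_le_liminf_mul {c : ℝ≥0∞} (hc : c ≠ ∞) {f : ℕ → ℝ≥0∞} {a : ℝ≥0∞}
    (hf : a ≤ liminf f atTop) : c * a ≤ liminf (fun m => c * f m) atTop := by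
  rw [ENNReal.liminf_const_mul_of_ne_top hc]
  gcongr

end Liminf

theorem Coercive.exists_norm_le {Y : Type*} [NormedAddCommGroup Y]
    {F : Y → ℝ≥0∞} (hF : Coercive F) {s : ℝ≥0∞} (hs : s < ∞) :
    ∃ M, ∀ y, F y ≤ s → ‖y‖ ≤ M := by
  have h := Filter.Tendsto.eventually_const_lt hs hF
  rw [eventually_comap] at h
  obtain ⟨M, hM⟩ := eventually_atTop.1 h
  refine ⟨M, fun y hy => ?_⟩
  by_contra! hlt
  exact (hM ‖y‖ hlt.le y rfl).not_ge hy

/-! ### Convex functionals and the a priori bound for `u`. -/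

section Functionals

variable {X Y : Type*} [NormedAddCommGroup X] [NormedSpace ℝ X]
  [NormedAddCommGroup Y] [NormedSpace ℝ Y]

/-- Uniform boundedness for the images in the bidual, which act on the complete space `StrongDual ℝ
X`. -/
theorem WeakTendsto.exists_norm_le {x : ℕ → X} {x₀ : X} (h : WeakTendsto x x₀) :
    ∃ C, ∀ m, ‖x m‖ ≤ C := by
  obtain ⟨C, hC⟩ := banach_steinhaus
    (g := fun m => NormedSpace.inclusionInDoubleDualLi ℝ (x m)) fun f => by
      obtain ⟨C, hC⟩ := (h f).norm.bddAbove_range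
      exact ⟨C, fun m => hC ⟨m, rfl⟩⟩
  exact ⟨C, fun m => by simpa only [LinearIsometry.norm_map] using hC m⟩

/-- A lower semicontinuous convex functional is weakly sequentially lower semicontinuous. -/
theorem weakLSC_of_convexOn {D : Y → ℝ≥0∞} (hlsc : LowerSemicontinuous D)
    (hconv : ConvexOn ℝ≥0 Set.univ D) : WeakLSC D := by
  intro y y₀ hy
  refine le_liminf_of_forall_frequently_le fun c hc => ?_
  refine WeakTendsto.mem_of_frequently_mem (C := {z | D z ≤ c}) hy ?_
    (hlsc.isClosed_preimage c) hc
  intro z hz w hw a b ha hb hab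
  lift a to ℝ≥0 using ha
  lift b to ℝ≥0 using hb
  have hab' : a + b = 1 := by exact_mod_cast hab
  calc D (a • z + b • w) ≤ a • D z + b • D w :=
        hconv.2 (Set.mem_univ z) (Set.mem_univ w) zero_le zero_le hab'
    _ ≤ a • c + b • c := by
        simp only [ENNReal.smul_def, smul_eq_mul]
        gcongr
        exacts [hz, hw]
    _ = c := by rw [← add_smul, hab', one_smul]

/-- A finite dimensional subspace splits into its intersection with the kernel of `A` and a subspace
on which `A` is bounded below. -/
theorem exists_complement_of_finiteDimensional (A : X →L[ℝ] Y) (U : Submodule ℝ X)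
    [FiniteDimensional ℝ U] :
    ∃ W : Submodule ℝ X, W ≤ U ∧ W ⊓ (U ⊓ LinearMap.ker (A : X →ₗ[ℝ] Y)) = ⊥ ∧
      W ⊔ (U ⊓ LinearMap.ker (A : X →ₗ[ℝ] Y)) = U ∧
      ∃ K : ℝ, 0 < K ∧ ∀ u ∈ W, ‖u‖ ≤ K * ‖A u‖ := by
  set N := U ⊓ LinearMap.ker (A : X →ₗ[ℝ] Y)
  obtain ⟨W', hW'⟩ := Submodule.exists_isCompl N
  have hinf : (W' ⊓ U) ⊓ N = ⊥ := by
    rw [eq_bot_iff, ← hW'.inf_eq_bot]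
    exact le_inf inf_le_right (inf_le_left.trans inf_le_left)
  refine ⟨W' ⊓ U, inf_le_right, hinf, ?_, ?_⟩
  -- The modular law, available since `N ≤ U`.
  · rw [sup_comm, ← sup_inf_assoc_of_le W' (inf_le_left : N ≤ U), hW'.sup_eq_top, top_inf_eq]
  · have : FiniteDimensional ℝ ↥(W' ⊓ U) := Submodule.finiteDimensional_of_le inf_le_right
    have hker : LinearMap.ker ((A : X →ₗ[ℝ] Y).comp (W' ⊓ U).subtype) = ⊥ := by
      rw [LinearMap.ker_eq_bot']
      intro w hw
      have hmem : (w : X) ∈ (W' ⊓ U) ⊓ N := ⟨w.2, w.2.2, hw⟩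
      rw [hinf, Submodule.mem_bot] at hmem
      exact Subtype.ext hmem
    obtain ⟨K, hK, hanti⟩ := LinearMap.exists_antilipschitzWith _ hker
    exact ⟨K, hK, fun u hu => hanti.le_mul_norm (map_zero _) ⟨u, hu⟩⟩

/-- Shifting along `U ∩ ker A` yields a priori bounds in terms of the energy. -/
theorem exists_bounded_shift {A : X →L[ℝ] Y} {R : X → ℝ≥0∞} {U W : Submodule ℝ X}
    {P : X →L[ℝ] U} (hR_inv : ∀ u, ∀ v ∈ U, R u = R (u + v)) {C : ℝ}
    (hR : ∀ u, ENNReal.ofReal ‖u - (P u : X)‖ ≤ ENNReal.ofReal C * R u)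
    (hW : W ⊔ (U ⊓ LinearMap.ker (A : X →ₗ[ℝ] Y)) = U) {K : ℝ} (hK : 0 < K)
    (hWK : ∀ u ∈ W, ‖u‖ ≤ K * ‖A u‖) {V M : ℝ} {r : ℝ≥0∞} (hr : r ≠ ∞) :
    ∃ B, ∀ u v, ‖v‖ ≤ V → R (u - v) ≤ r → ‖A u‖ ≤ M →
      ∃ u', A u' = A u ∧ R (u' - v) = R (u - v) ∧ ‖u'‖ ≤ B := by
  set c := (ENNReal.ofReal C * r).toReal
  refine ⟨V + c + K * (M + ‖A‖ * V + ‖A‖ * c), fun u v hv hur hu => ?_⟩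
  set w := u - v
  have hwP : ‖w - (P w : X)‖ ≤ c := by
    rw [← ENNReal.ofReal_le_iff_le_toReal (ENNReal.mul_ne_top ENNReal.ofReal_ne_top hr)]
    exact (hR w).trans (by gcongr)
  have hmem : (P w : X) ∈ W ⊔ (U ⊓ LinearMap.ker (A : X →ₗ[ℝ] Y)) := hW.ge (P w).2
  -- Only `k` is uncontrolled, and subtracting it changes neither `A u` nor `R (u - v)`. The part
  -- `x` in `W` is bounded through `A x`.
  obtain ⟨x, hx, k, ⟨hkU, hkA⟩, hxk⟩ := Submodule.mem_sup.1 hmem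
  have hkA' : A k = 0 := hkA
  have hAx : A x = A u - A v - A (w - (P w : X)) := by
    rw [← hxk, ← map_sub, ← map_sub]
    have : u - v - (w - (x + k)) = x + k := by simp only [w]; abel
    rw [this, map_add, hkA', add_zero]
  have hxn : ‖x‖ ≤ K * (M + ‖A‖ * V + ‖A‖ * c) := by
    refine (hWK x hx).trans ?_
    gcongr
    rw [hAx]
    calc ‖A u - A v - A (w - (P w : X))‖ ≤ ‖A u‖ + ‖A v‖ + ‖A (w - (P w : X))‖ :=
          (norm_sub_le _ _).trans (by gcongr; exact norm_sub_le _ _)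
      _ ≤ M + ‖A‖ * V + ‖A‖ * c := by
          gcongr
          · exact (A.le_opNorm v).trans (by gcongr)
          · exact (A.le_opNorm _).trans (by gcongr)
  refine ⟨u - k, by rw [map_sub, hkA', sub_zero], ?_, ?_⟩
  · rw [hR_inv (u - v) (-k) (U.neg_mem hkU)]
    congr 1
    abel
  · have : u - k = v + (w - (P w : X)) + x := by
      rw [← hxk]
      simp only [w]
      abel
    rw [this]
    exact (norm_add₃_le).trans (by gcongr)

end Functionals

/-! ### Compactness and lower semicontinuity for network parameters. -/

section Network

variable {q : ℝ≥0∞} [Fact (1 ≤ q)] {a : Architecture} {Ω S : BddOpen d}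

/-- The output `μ¹ *₁ θ¹` of the network. -/
noncomputable def networkOutput (hq : q ≤ 2) (μ : Latent a Ω S) (θ : Kernels a S) : LpOn q Ω :=
  layerConv hq (μ ⟨0, a.depth_pos⟩) (θ ⟨0, a.depth_pos⟩) ⟨0, a.width_zero ▸ Nat.one_pos⟩

/-- Convergence of network parameters: weak* for the measures, weak for the kernels. -/
structure ParamTendsto (μ : ℕ → Latent a Ω S) (θ : ℕ → Kernels a S) (μ₀ : Latent a Ω S)
    (θ₀ : Kernels a S) : Prop where
  latent : ∀ l n φ, Tendsto (fun m => μ m l n φ) atTop (𝓝 (μ₀ l n φ))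
  kernels : ∀ l e, WeakTendsto (fun m => θ m l e) (θ₀ l e)

theorem exists_subseq_paramTendsto {μ : ℕ → Latent a Ω S} {θ : ℕ → Kernels a S} {B : ℝ}
    (hμ : ∀ m l n, ‖μ m l n‖ ≤ B) (hθ : ∀ m l e, ‖θ m l e‖ ≤ 1) :
    ∃ μ₀ θ₀, ∃ φ : ℕ → ℕ, StrictMono φ ∧ ParamTendsto (μ ∘ φ) (θ ∘ φ) μ₀ θ₀ := by
  obtain ⟨φ, hφ, h⟩ := exists_common_subseq
    (ι := (Σ l : Fin a.depth, Fin (a.width (l + 1))) ⊕ (Σ l : Fin a.depth, a.edges l))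
    (P := fun i φ => match i with
      | .inl ⟨l, n⟩ => ∃ ν : RadonMeasure (dom Ω S (l + 1)),
          ∀ ψ, Tendsto (fun m => μ (φ m) l n ψ) atTop (𝓝 (ν ψ))
      | .inr ⟨l, e⟩ => ∃ g : LpOn 2 S, WeakTendsto (fun m => θ (φ m) l e) g)
    (by
      rintro (⟨l, n⟩ | ⟨l, e⟩) φ hφ
      · obtain ⟨ν, ψ, hψ, h⟩ := exists_subseq_weakStar (f := fun m => μ (φ m) l n)
          fun m => hμ (φ m) l n
        exact ⟨ψ, hψ, ν, h⟩
      · have : Fact ((2 : ℝ≥0∞) ≠ ∞) := ⟨by simp⟩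
        obtain ⟨g, ψ, hψ, h⟩ := exists_subseq_weakTendsto (x := fun m => θ (φ m) l e)
          fun m => hθ (φ m) l e
        exact ⟨ψ, hψ, g, h⟩)
    (by
      rintro (⟨l, n⟩ | ⟨l, e⟩) φ ψ ⟨ν, hν⟩ hψ
      · exact ⟨ν, fun x => (hν x).comp hψ.tendsto_atTop⟩
      · exact ⟨ν, hν.comp hψ⟩)
  have h1 : ∀ (l : Fin a.depth) (n : Fin (a.width (l + 1))), ∃ ν : RadonMeasure (dom Ω S (l + 1)),
      ∀ ψ, Tendsto (fun m => μ (φ m) l n ψ) atTop (𝓝 (ν ψ)) := fun l n => h (.inl ⟨l, n⟩)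
  have h2 : ∀ (l : Fin a.depth) (e : a.edges l), ∃ g : LpOn 2 S, WeakTendsto (fun m => θ (φ m) l e) g :=
    fun l e => h (.inr ⟨l, e⟩)
  choose μ₀ hμ₀ using h1
  choose θ₀ hθ₀ using h2
  exact ⟨μ₀, θ₀, φ, hφ, hμ₀, hθ₀⟩

theorem ParamTendsto.comp {μ : ℕ → Latent a Ω S} {θ : ℕ → Kernels a S} {μ₀ : Latent a Ω S}
    {θ₀ : Kernels a S} (h : ParamTendsto μ θ μ₀ θ₀) {φ : ℕ → ℕ} (hφ : StrictMono φ) :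
    ParamTendsto (μ ∘ φ) (θ ∘ φ) μ₀ θ₀ where
  latent l n ψ := (h.latent l n ψ).comp hφ.tendsto_atTop
  kernels l e := (h.kernels l e).comp hφ

theorem ParamTendsto.networkOutput (hq : q ≤ 2) {μ : ℕ → Latent a Ω S} {θ : ℕ → Kernels a S}
    {μ₀ : Latent a Ω S} {θ₀ : Kernels a S} (h : ParamTendsto μ θ μ₀ θ₀) {B : ℝ}
    (hμ : ∀ m l n, ‖μ m l n‖ ≤ B) (hθ : ∀ m l e, ‖θ m l e‖ ≤ 1) :
    WeakTendsto (fun m => networkOutput hq (μ m) (θ m)) (networkOutput hq μ₀ θ₀) :=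
  weakTendsto_layerConv hq (fun m => hμ m _) (h.latent _) (h.kernels _) (fun m => hθ m _) _

/-- Balls are weakly closed and bounded linear maps are weakly continuous; the output constraint
holds because `v` is defined as the output of the limit. -/
theorem ParamTendsto.feasible (hq : q ≤ 2) {Nc : ℕ}
    {Z : Kernels a S →L[ℝ] EuclideanSpace ℝ (Fin Nc)}
    {μ : ℕ → Latent a Ω S} {θ : ℕ → Kernels a S}
    {μ₀ : Latent a Ω S} {θ₀ : Kernels a S} (h : ParamTendsto μ θ μ₀ θ₀)
    (hf : ∀ m, ∃ v : LpOn q Ω, Feasible hq Z v (μ m) (θ m)) :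
    Feasible hq Z (GenPrior.networkOutput hq μ₀ θ₀) μ₀ θ₀ where
  output := rfl
  norm_le l e := (h.kernels l e).norm_le fun m => (hf m).choose_spec.norm_le l e
  linear := by
    have hw : WeakTendsto (fun m => Z (θ m)) (Z θ₀) :=
      (WeakTendsto.pi fun l => WeakTendsto.pi fun e => h.kernels l e).map Z
    have : ‖Z θ₀‖ ≤ 0 := hw.norm_le fun m => by rw [(hf m).choose_spec.linear, norm_zero]
    exact norm_le_zero_iff.1 this

/-- Dual norms are weak* lower semicontinuous. The arguments of the penalties converge weak* because
the layer convolutions converge weakly in L^q. -/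
theorem ParamTendsto.cost_le (hq : q ≤ 2) {J : Penalties a Ω S} (hJ : ∀ l, WeakStarLSC (J l))
    {μ : ℕ → Latent a Ω S} {θ : ℕ → Kernels a S}
    {μ₀ : Latent a Ω S} {θ₀ : Kernels a S} (h : ParamTendsto μ θ μ₀ θ₀) {B : ℝ}
    (hμ : ∀ m l n, ‖μ m l n‖ ≤ B) (hθ : ∀ m l e, ‖θ m l e‖ ≤ 1) :
    cost hq J μ₀ θ₀ ≤ liminf (fun m => cost hq J (μ m) (θ m)) atTop := by
  refine add_le_liminf_add (sum_le_liminf_sum _ fun l _ => sum_le_liminf_sum _ fun n _ => ?_)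
    (sum_le_liminf_sum _ fun i _ => hJ i (fun m k => μ m ⟨i, by omega⟩ k -
        toMeasure (layerConv hq (Ω := dom Ω S (i + 1)) (μ m ⟨i + 1, by omega⟩)
          (θ m ⟨i + 1, by omega⟩) k)) _ fun k φ => ?_)
  · refine le_liminf_of_forall_frequently_le fun c hc => ?_
    by_cases hctop : c = ∞
    · simp [hctop]
    · rw [ENNReal.ofReal_le_iff_le_toReal hctop]
      refine norm_le_of_frequently_norm_le (h.latent l n) (hc.mono fun m hm => ?_)
      rwa [ENNReal.ofReal_le_iff_le_toReal hctop] at hm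
  · have hw := weakTendsto_layerConv hq (Ω := dom Ω S (i + 1)) (S := S)
      (E := a.edges ⟨i + 1, by omega⟩)
      (μ := fun m => μ m ⟨i + 1, by omega⟩) (μ₀ := μ₀ ⟨i + 1, by omega⟩)
      (θ := fun m => θ m ⟨i + 1, by omega⟩) (θ₀ := θ₀ ⟨i + 1, by omega⟩)
      (fun m => hμ m _) (h.latent _) (h.kernels _) (fun m => hθ m _) k
    exact (h.latent ⟨i, by omega⟩ k φ).sub (hw.tendsto_toMeasure φ)

theorem ofReal_norm_le_cost (hq : q ≤ 2) (J : Penalties a Ω S) (μ : Latent a Ω S)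
    (θ : Kernels a S) (l : Fin a.depth) (n : Fin (a.width (l + 1))) :
    ENNReal.ofReal ‖μ l n‖ ≤ cost hq J μ θ :=
  calc ENNReal.ofReal ‖μ l n‖ ≤ ∑ n, ENNReal.ofReal ‖μ l n‖ :=
        Finset.single_le_sum (f := fun n => ENNReal.ofReal ‖μ l n‖) (fun _ _ => zero_le)
          (Finset.mem_univ n)
    _ ≤ ∑ l, ∑ n, ENNReal.ofReal ‖μ l n‖ :=
        Finset.single_le_sum (f := fun l => ∑ n, ENNReal.ofReal ‖μ l n‖) (fun _ _ => zero_le)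
          (Finset.mem_univ l)
    _ ≤ cost hq J μ θ := le_self_add

theorem conv_zero (hq : q ≤ 2) (μ : RadonMeasure (Ω.sub S)) : conv hq μ 0 = 0 := by
  refine (existsUnique_conv hq μ 0).unique (conv_spec hq μ 0) fun φ => ?_
  have h1 : corr Ω S 0 φ = 0 := by
    have := norm_corr_le Ω S 0 φ
    simp only [norm_zero, mul_zero] at this
    exact norm_le_zero_iff.1 ((C0.norm_le le_rfl).2 this)
  rw [h1, map_zero]
  have h2 : (fun x => (0 : LpOn q Ω) x * zeroExt Ω φ x) =ᵐ[Ω.vol] 0 := by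
    filter_upwards [Lp.coeFn_zero ℝ q Ω.vol] with x hx
    rw [hx]
    simp
  simpa using (integral_congr_ae h2)

theorem layerConv_zero (hq : q ≤ 2) {N N' : ℕ} {E : Finset (Fin N × Fin N')}
    (μ : Fin N → RadonMeasure (Ω.sub S)) (k : Fin N') :
    layerConv hq μ (0 : E → LpOn 2 S) k = 0 := by
  refine Finset.sum_eq_zero fun e _ => ?_
  rw [Pi.zero_apply, conv_zero, ite_self]

theorem toMeasure_zero : toMeasure (0 : LpOn q Ω) = 0 := by
  ext φ
  have h2 : (fun x => (0 : LpOn q Ω) x * zeroExt Ω φ x) =ᵐ[Ω.vol] 0 := by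
    filter_upwards [Lp.coeFn_zero ℝ q Ω.vol] with x hx
    rw [hx]
    simp
  change ∫ x, (0 : LpOn q Ω) x * zeroExt Ω φ x ∂Ω.vol = 0
  simpa using (integral_congr_ae h2)

theorem feasible_zero (hq : q ≤ 2) {Nc : ℕ} (Z : Kernels a S →L[ℝ] EuclideanSpace ℝ (Fin Nc)) :
    Feasible hq Z (0 : LpOn q Ω) (0 : Latent a Ω S) 0 where
  output := (layerConv_zero hq _ _).symm
  norm_le l e := by simp
  linear := map_zero Z

theorem cost_zero (hq : q ≤ 2) {J : Penalties a Ω S} (hJ : ∀ l, J l 0 = 0) :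
    cost hq J (0 : Latent a Ω S) 0 = 0 := by
  have h1 : ∀ i : Fin (a.depth - 1), J i (fun k =>
      (0 : Latent a Ω S) ⟨i, by omega⟩ k -
        toMeasure (layerConv hq (Ω := dom Ω S (i + 1)) ((0 : Latent a Ω S) ⟨i + 1, by omega⟩)
          ((0 : Kernels a S) ⟨i + 1, by omega⟩) k)) = 0 := fun i => by
    rw [← hJ i]
    congr 1
    funext k
    have h := layerConv_zero hq (Ω := dom Ω S (i + 1)) (S := S)
      (E := a.edges ⟨i + 1, by omega⟩) ((0 : Latent a Ω S) ⟨i + 1, by omega⟩) k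
    change (0 : RadonMeasure _) - toMeasure (layerConv hq (Ω := dom Ω S (i + 1))
      ((0 : Latent a Ω S) ⟨i + 1, by omega⟩) 0 k) = 0
    rw [h, toMeasure_zero, sub_zero]
  unfold cost
  simp only [h1, Finset.sum_const_zero, add_zero]
  simp

end Network

/-! ### Positivity of the weights. -/

theorem sR_pos {ν : ℝ} (h0 : 0 < ν) (h1 : ν < 1) : 0 < sR ν :=
  div_pos h0 (lt_min h0 (sub_pos.2 h1))

theorem sG_pos {ν : ℝ} (h0 : 0 < ν) (h1 : ν < 1) : 0 < sG ν :=
  div_pos (sub_pos.2 h1) (lt_min h0 (sub_pos.2 h1))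

theorem le_div_of_mul_le {c : ℝ} (hc : 0 < c) {x B : ℝ≥0∞}
    (h : ENNReal.ofReal c * x ≤ B) : x ≤ B / ENNReal.ofReal c := by
  rw [ENNReal.le_div_iff_mul_le (Or.inl (by simpa using hc)) (Or.inl ENNReal.ofReal_ne_top),
    mul_comm]
  exact h

theorem div_ofReal_ne_top {c : ℝ} (hc : 0 < c) {B : ℝ≥0∞} (hB : B ≠ ∞) :
    B / ENNReal.ofReal c ≠ ∞ :=
  ENNReal.div_ne_top hB (by simpa using hc)

/-! ### The joint energy and minimizing sequences. -/

section Existence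

variable {Ω S : BddOpen d} {q : ℝ≥0∞} [Fact (1 ≤ q)] {Y : Type*} {a : Architecture}

/-- The energy in terms of `u` and the network parameters. -/
noncomputable def paramEnergy (hq : q ≤ 2) (lam ν : ℝ) (D : Y → ℝ≥0∞) (A : LpOn q Ω → Y)
    (R : LpOn q Ω → ℝ≥0∞) (J : Penalties a Ω S) (u : LpOn q Ω) (μ : Latent a Ω S)
    (θ : Kernels a S) : ℝ≥0∞ :=
  ENNReal.ofReal lam * D (A u) + ENNReal.ofReal (sR ν) * R (u - networkOutput hq μ θ) +
    ENNReal.ofReal (sG ν) * cost hq J μ θ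

theorem energy_le_paramEnergy (hq : q ≤ 2) (lam ν : ℝ) (D : Y → ℝ≥0∞) (A : LpOn q Ω → Y)
    (R : LpOn q Ω → ℝ≥0∞) (J : Penalties a Ω S) {Nc : ℕ}
    {Z : Kernels a S →L[ℝ] EuclideanSpace ℝ (Fin Nc)} {u v : LpOn q Ω} {μ : Latent a Ω S}
    {θ : Kernels a S} (h : Feasible hq Z v μ θ) :
    energy lam ν D A R (genPrior hq J Z) u v ≤ paramEnergy hq lam ν D A R J u μ θ := by
  have hv : v = networkOutput hq μ θ := h.output
  unfold energy paramEnergy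
  rw [← hv]
  gcongr
  exact iInf₂_le_of_le μ θ (iInf_le _ h)

/-- A positive finite weight commutes with the infimum in the prior, even over the empty set; weight
zero would turn the value `∞` at an infeasible `v` into zero. -/
theorem le_energy_of_forall_le_paramEnergy (hq : q ≤ 2) {lam ν : ℝ} (hν : 0 < sG ν)
    {D : Y → ℝ≥0∞} {A : LpOn q Ω → Y} {R : LpOn q Ω → ℝ≥0∞} {J : Penalties a Ω S} {Nc : ℕ}
    {Z : Kernels a S →L[ℝ] EuclideanSpace ℝ (Fin Nc)} {u v : LpOn q Ω} {I : ℝ≥0∞}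
    (h : ∀ μ θ, Feasible hq Z v μ θ → I ≤ paramEnergy hq lam ν D A R J u μ θ) :
    I ≤ energy lam ν D A R (genPrior hq J Z) u v := by
  have h0 : ENNReal.ofReal (sG ν) ≠ 0 := by simpa using hν
  unfold energy genPrior
  simp only [ENNReal.mul_iInf_of_ne h0 ENNReal.ofReal_ne_top, ENNReal.add_iInf]
  refine le_iInf fun μ => le_iInf fun θ => le_iInf fun hf => ?_
  have hv : v = networkOutput hq μ θ := hf.output
  have := h μ θ hf
  unfold paramEnergy at this
  rwa [← hv] at this

/-- Minimizing sequences with uniformly bounded values exist. -/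
theorem exists_minimizing_seq {α : Type*} (F : α → ℝ≥0∞) {x₀ : α} (hx₀ : F x₀ < ∞) :
    ∃ x : ℕ → α, (∃ B, B ≠ ∞ ∧ ∀ m, F (x m) ≤ B) ∧
      Tendsto (fun m => F (x m)) atTop (𝓝 (⨅ y, F y)) := by
  obtain ⟨e, hanti, he, hmem⟩ := exists_seq_tendsto_sInf (S := Set.range F) ⟨F x₀, x₀, rfl⟩
    (OrderBot.bddBelow _)
  choose x hx using hmem
  have hlt : sInf (Set.range F) < ∞ := (sInf_le (Set.mem_range_self x₀)).trans_lt hx₀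
  -- Early values may be infinite; past `N` the antitone sequence `e` stays below the finite `e N`.
  obtain ⟨N, hN⟩ := (he.eventually_lt_const hlt).exists
  have hx' : (fun m => F (x (m + N))) = fun m => e (m + N) := funext fun m => hx _
  have hlim : Tendsto (fun m => F (x (m + N))) atTop (𝓝 (⨅ y, F y)) := by
    rw [hx', ← sInf_range]
    exact he.comp (tendsto_add_atTop_nat N)
  refine ⟨fun m => x (m + N), ⟨e N, hN.ne, fun m => ?_⟩, hlim⟩
  rw [hx]
  exact hanti (Nat.le_add_left N m)

end Existence

end GenPrior

/-! ### The existence theorem. -/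

theorem mainTheorem1 {d : ℕ} (Ω S : GenPrior.BddOpen d)
    -- exponent and forward operator
    (q : ℝ≥0∞) [Fact (1 ≤ q)] (hq1 : 1 < q) (hq2 : q ≤ 2)
    {Y : Type*} [NormedAddCommGroup Y] [NormedSpace ℝ Y] [CompleteSpace Y]
    (A : GenPrior.LpOn q Ω →L[ℝ] Y)
    -- weights
    (lam ν : ℝ) (hlam : 0 < lam) (hν0 : 0 < ν) (hν1 : ν < 1)
    -- data fidelity
    (D : Y → ℝ≥0∞) (hD_proper : GenPrior.Proper D) (hD_coercive : GenPrior.Coercive D)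
    (hD_lsc : LowerSemicontinuous D) (hD_convex : ConvexOn ℝ≥0 Set.univ D)
    -- generative prior
    (a : GenPrior.Architecture) (J : GenPrior.Penalties a Ω S)
    (hJ_lsc : ∀ l, GenPrior.WeakStarLSC (J l)) (hJ_zero : ∀ l, J l 0 = 0)
    {Nc : ℕ} (Z : GenPrior.Kernels a S →L[ℝ] EuclideanSpace ℝ (Fin Nc))
    -- second prior
    (R : GenPrior.LpOn q Ω → ℝ≥0∞) (hR_proper : GenPrior.Proper R) (hR_lsc : GenPrior.WeakLSC R)
    (U : Submodule ℝ (GenPrior.LpOn q Ω)) (hU_closed : IsClosed (U : Set (GenPrior.LpOn q Ω)))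
    (P : GenPrior.LpOn q Ω →L[ℝ] U) (hP : ∀ u : U, P u = u)
    (hR_inv : ∀ u, ∀ v ∈ U, R u = R (u + v))
    (C : ℝ) (hC : 0 < C)
    (hR_poincare : ∀ u, ENNReal.ofReal ‖u - (P u : GenPrior.LpOn q Ω)‖ ≤ ENNReal.ofReal C * R u)
    (hU : FiniteDimensional ℝ U ∨
      ∃ W : Submodule ℝ (GenPrior.LpOn q Ω), W ≤ U ∧
        W ⊓ (U ⊓ LinearMap.ker (A : GenPrior.LpOn q Ω →ₗ[ℝ] Y)) = ⊥ ∧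
        W ⊔ (U ⊓ LinearMap.ker (A : GenPrior.LpOn q Ω →ₗ[ℝ] Y)) = U ∧
        ∃ K : ℝ, 0 < K ∧ ∀ u ∈ W, ‖u‖ ≤ K * ‖A u‖)
    -- a point of finite energy
    (hfin : ∃ u : GenPrior.LpOn q Ω, R u < ∞ ∧ D (A u) < ∞) :
    ∃ u v : GenPrior.LpOn q Ω, ∀ u' v' : GenPrior.LpOn q Ω,
      GenPrior.energy lam ν D A R (GenPrior.genPrior hq2 J Z) u v ≤
        GenPrior.energy lam ν D A R (GenPrior.genPrior hq2 J Z) u' v' := by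
  have hνR := GenPrior.sR_pos hν0 hν1
  have hνG := GenPrior.sG_pos hν0 hν1
  have : Fact (q ≠ ∞) := ⟨(hq2.trans_lt (by simp)).ne⟩
  have : UniformConvexSpace (GenPrior.LpOn q Ω) :=
    GenPrior.uniformConvexSpace_Lp hq1 (hq2.trans_lt (by simp)).ne
  obtain ⟨W, -, -, hWU, K, hK, hWK⟩ : ∃ W : Submodule ℝ (GenPrior.LpOn q Ω), W ≤ U ∧
      W ⊓ (U ⊓ LinearMap.ker (A : GenPrior.LpOn q Ω →ₗ[ℝ] Y)) = ⊥ ∧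
      W ⊔ (U ⊓ LinearMap.ker (A : GenPrior.LpOn q Ω →ₗ[ℝ] Y)) = U ∧
      ∃ K : ℝ, 0 < K ∧ ∀ u ∈ W, ‖u‖ ≤ K * ‖A u‖ := by
    rcases hU with hU | hU
    · exact GenPrior.exists_complement_of_finiteDimensional A U
    · exact hU
  -- minimize over `u` and the feasible network parameters
  let F : {x : GenPrior.LpOn q Ω × GenPrior.Latent a Ω S × GenPrior.Kernels a S //
      ∃ v : GenPrior.LpOn q Ω, GenPrior.Feasible hq2 Z v x.2.1 x.2.2} → ℝ≥0∞ := fun x =>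
    GenPrior.paramEnergy hq2 lam ν D A R J x.1.1 x.1.2.1 x.1.2.2
  obtain ⟨û, hRû, hDû⟩ := hfin
  -- Zero parameters have output and cost zero, so only the finite terms `D (A û)` and `R û` remain.
  have hfin₀ : F ⟨(û, 0, 0), 0, GenPrior.feasible_zero hq2 Z⟩ < ∞ := by
    have hout : GenPrior.networkOutput hq2 (0 : GenPrior.Latent a Ω S) 0 = 0 :=
      (GenPrior.feasible_zero hq2 Z).output.symm
    simp only [F, GenPrior.paramEnergy, hout, sub_zero, GenPrior.cost_zero hq2 hJ_zero, mul_zero,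
      add_zero]
    exact ENNReal.add_lt_top.2 ⟨ENNReal.mul_lt_top ENNReal.ofReal_lt_top hDû,
      ENNReal.mul_lt_top ENNReal.ofReal_lt_top hRû⟩
  obtain ⟨x, ⟨B, hB, hxB⟩, hlim⟩ := GenPrior.exists_minimizing_seq F hfin₀
  let μ := fun m => (x m).1.2.1
  let θ := fun m => (x m).1.2.2
  have hfeas : ∀ m, ∃ v : GenPrior.LpOn q Ω, GenPrior.Feasible hq2 Z v (μ m) (θ m) :=
    fun m => (x m).2
  have hθ : ∀ m l e, ‖θ m l e‖ ≤ 1 := fun m => (hfeas m).choose_spec.norm_le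
  have hμ : ∀ m l n, ‖μ m l n‖ ≤ (B / ENNReal.ofReal (GenPrior.sG ν)).toReal := fun m l n => by
    rw [← ENNReal.ofReal_le_iff_le_toReal (GenPrior.div_ofReal_ne_top hνG hB)]
    exact (GenPrior.ofReal_norm_le_cost hq2 J (μ m) (θ m) l n).trans
      (GenPrior.le_div_of_mul_le hνG (le_add_self.trans (hxB m)))
  obtain ⟨μ₀, θ₀, φ, hφ, hparam⟩ := GenPrior.exists_subseq_paramTendsto hμ hθ
  have hout := hparam.networkOutput hq2 (fun m => hμ (φ m)) fun m => hθ (φ m)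
  obtain ⟨V, hV⟩ := hout.exists_norm_le
  -- shift the first component along `U ∩ ker A`
  obtain ⟨M, hM⟩ := hD_coercive.exists_norm_le
    (GenPrior.div_ofReal_ne_top hlam hB).lt_top
  obtain ⟨T, hT⟩ := GenPrior.exists_bounded_shift (V := V) (M := M) hR_inv hR_poincare hWU hK hWK
    (GenPrior.div_ofReal_ne_top hνR hB)
  have hshift : ∀ m, ∃ u', A u' = A (x (φ m)).1.1 ∧
      R (u' - GenPrior.networkOutput hq2 (μ (φ m)) (θ (φ m))) =
        R ((x (φ m)).1.1 - GenPrior.networkOutput hq2 (μ (φ m)) (θ (φ m))) ∧ ‖u'‖ ≤ T := fun m => by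
    have hDR := le_self_add.trans (hxB (φ m))
    exact hT _ _ (hV m) (GenPrior.le_div_of_mul_le hνR (le_add_self.trans hDR))
      (hM _ (GenPrior.le_div_of_mul_le hlam (le_self_add.trans hDR)))
  choose u huA huR hu using hshift
  -- A second extraction: the bound `T` depends on the bound `V` for the outputs, obtained from
  -- their weak convergence along `φ`.
  obtain ⟨u₀, ψ, hψ, hu₀⟩ := GenPrior.exists_subseq_weakTendsto hu
  have hparam' := hparam.comp hψ
  have hout' := hout.comp hψ
  have hmin : GenPrior.paramEnergy hq2 lam ν D A R J u₀ μ₀ θ₀ ≤ ⨅ y, F y := by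
    have henergy : ∀ m, GenPrior.paramEnergy hq2 lam ν D A R J (u (ψ m)) (μ (φ (ψ m)))
        (θ (φ (ψ m))) = F (x (φ (ψ m))) := fun m => by
      simp only [F, GenPrior.paramEnergy, huA]
      rw [huR]
    rw [← ((hlim.comp hφ.tendsto_atTop).comp hψ.tendsto_atTop).liminf_eq]
    change _ ≤ liminf (fun m => F (x (φ (ψ m)))) atTop
    simp only [← henergy]
    refine GenPrior.add_le_liminf_add (GenPrior.add_le_liminf_add ?_ ?_) ?_
    · exact GenPrior.mul_le_liminf_mul ENNReal.ofReal_ne_top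
        (GenPrior.weakLSC_of_convexOn hD_lsc hD_convex _ _ (hu₀.map A))
    · exact GenPrior.mul_le_liminf_mul ENNReal.ofReal_ne_top
        (hR_lsc _ _ (hu₀.sub hout'))
    · exact GenPrior.mul_le_liminf_mul ENNReal.ofReal_ne_top
        (hparam'.cost_le hq2 hJ_lsc (fun m => hμ _) fun m => hθ _)
  refine ⟨u₀, GenPrior.networkOutput hq2 μ₀ θ₀, fun u' v' => ?_⟩
  refine (GenPrior.energy_le_paramEnergy hq2 lam ν D A R J
    (hparam.feasible hq2 fun m => hfeas _)).trans (hmin.trans ?_)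
  exact GenPrior.le_energy_of_forall_le_paramEnergy hq2 hνG fun μ' θ' h =>
    iInf_le F ⟨(u', μ', θ'), v', h⟩
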